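/- Let $z\in\mathbb C$ with $\operatorname{Re} z>0$, and for $0<q<1$ put $[x]_q=\frac{1-q^x}{1-q}$; all powers are principal. The Hurwitz series $\sum_{k\ge 0}(k+z)^{-s}$ converges absolutely for $\operatorname{Re}s>1$ and has a meromorphic continuation $\zeta(s,z)$ to $s\in\mathbb C$, holomorphic for $s\neq 1$. For $0<q<1$ the series $\sum_{k\ge 0} q^{s(k+1)}/[k+z]_q^{\,s}$ converges absolutely for $\operatorname{Re}s>0$ and has a meromorphic continuation $\zeta(s,z:q)$ to $s\in\mathbb C$, holomorphic outside the points $s=-r+\frac{2\pi i}{\log q}\,l$ ($r\in\mathbb Z_{\ge 0}$, $l\in\mathbb Z$). Let $$\zeta^*(s,z:q)=\zeta(s,z:q)+\frac{(q-q^2)^s\,q^{-zs}}{\log q}\,\frac{\pi}{\sin \pi s}.$$ For every $0<q<1$, the singularities of $\zeta^*(s,z:q)$ in $s$ at the points $s=0,-1,-2,\dots$ are removable; let $\zeta^*(s,z:q)$ denote at these points the value that removes the singularity. Then for every $s\in\mathbb C$ that is not a positive integer, $$\lim_{q\to 1-0}\zeta^*(s,z:q)=\zeta(s,z).$$ (For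 a given non-integer $s$ the point $s$ is not a pole of $\zeta(\cdot,z:q)$ as soon as $q$ is close enough to $1$.) -/

import Mathlib

open Filter Topology

/-- `F` is the meromorphic continuation to `ℂ` of the function `s ↦ ∑ a k s`, defined by an
(absolutely) convergent series on the half plane `re s > c`. The value at a point where the
continuation is finite is its true value (removable singularities are filled in); at a pole the
value is the conventional one of `MeromorphicNFOn`, namely `0`. -/
structure IsSeriesContinuation (a : ℕ → ℂ → ℂ) (c : ℝ) (F : ℂ → ℂ) : Prop where
  meromorphic : MeromorphicNFOn F Set.univ
  hasSum : ∀ s : ℂ, c < s.re → HasSum (fun k => a k s) (F s)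

/-- There is at most one continuation. -/
theorem IsSeriesContinuation.unique {a : ℕ → ℂ → ℂ} {c : ℝ} {F G : ℂ → ℂ}
    (hF : IsSeriesContinuation a c F) (hG : IsSeriesContinuation a c G) : F = G := by
  have hm : MeromorphicOn (F - G) Set.univ := fun x hx =>
    (hF.meromorphic hx).meromorphicAt.sub (hG.meromorphic hx).meromorphicAt
  have h0 : meromorphicOrderAt (F - G) ((c + 1 : ℝ) : ℂ) = ⊤ := by
    rw [meromorphicOrderAt_eq_top_iff]
    have hU : {s : ℂ | c < s.re} ∈ 𝓝 ((c + 1 : ℝ) : ℂ) :=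
      (isOpen_lt continuous_const Complex.continuous_re).mem_nhds (by simp)
    filter_upwards [nhdsWithin_le_nhds hU] with s hs
    simp [(hF.hasSum s hs).unique (hG.hasSum s hs)]
  funext x
  have hx : meromorphicOrderAt (F - G) x = ⊤ := by
    by_contra hne
    exact hm.meromorphicOrderAt_ne_top_of_isPreconnected isPreconnected_univ
      (Set.mem_univ x) (Set.mem_univ _) hne h0
  rw [meromorphicOrderAt_eq_top_iff] at hx
  have he : F =ᶠ[𝓝[≠] x] G := by
    filter_upwards [hx] with s hs
    exact sub_eq_zero.1 hs
  exact (((hF.meromorphic (Set.mem_univ x)).eventuallyEq_nhdsNE_iff_eventuallyEq_nhds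
    (hG.meromorphic (Set.mem_univ x))).1 he).eq_of_nhds

open Classical in
/-- The meromorphic continuation of `s ↦ ∑ a k s` from the half plane `re s > c` to `ℂ`
(the zero function if there is none). -/
noncomputable def seriesContinuation (a : ℕ → ℂ → ℂ) (c : ℝ) : ℂ → ℂ :=
  if h : ∃ F, IsSeriesContinuation a c F then h.choose else 0

/-- Any continuation is the one given by `seriesContinuation`. -/
theorem IsSeriesContinuation.eq_seriesContinuation {a : ℕ → ℂ → ℂ} {c : ℝ} {F : ℂ → ℂ}
    (hF : IsSeriesContinuation a c F) : seriesContinuation a c = F := by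
  have h : ∃ F, IsSeriesContinuation a c F := ⟨F, hF⟩
  rw [seriesContinuation, dif_pos h]
  exact h.choose_spec.unique hF

/-- The terms `1 / (k + z) ^ s` of the Hurwitz zeta series. -/
noncomputable def hurwitzTerm (z : ℂ) (k : ℕ) (s : ℂ) : ℂ :=
  1 / ((k : ℂ) + z) ^ s

/-- The Hurwitz zeta function `s ↦ ζ(s, z)`, for complex `z` with `0 < re z`: the meromorphic
continuation of `∑ 1 / (k + z) ^ s` from `re s > 1`. -/
noncomputable def complexHurwitzZeta (z : ℂ) : ℂ → ℂ :=
  seriesContinuation (hurwitzTerm z) 1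

/-- The `q`-number `[x]_q = (1 - q ^ x) / (1 - q)`. -/
noncomputable def qNumber (q : ℝ) (x : ℂ) : ℂ :=
  (1 - (q : ℂ) ^ x) / (1 - (q : ℂ))

/-- The terms `q ^ (s (k + 1)) / [k + z]_q ^ s` of the `q`-Hurwitz zeta series. -/
noncomputable def qHurwitzTerm (q : ℝ) (z : ℂ) (k : ℕ) (s : ℂ) : ℂ :=
  (q : ℂ) ^ (s * ((k : ℂ) + 1)) / (qNumber q ((k : ℂ) + z)) ^ s

/-- The `q`-Hurwitz zeta function `s ↦ ζ(s, z : q)`: the meromorphic continuation of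
`∑ q ^ (s (k + 1)) / [k + z]_q ^ s` from `re s > 0`. -/
noncomputable def qHurwitzZeta (q : ℝ) (z : ℂ) : ℂ → ℂ :=
  seriesContinuation (qHurwitzTerm q z) 0

/-- The corrected function
`ζ(s, z : q) + (q - q²) ^ s * q ^ (-z s) / log q * (π / sin (π s))`. -/
noncomputable def correctedQHurwitzZeta (q : ℝ) (z s : ℂ) : ℂ :=
  qHurwitzZeta q z s +
    ((q : ℂ) - (q : ℂ) ^ 2) ^ s * (q : ℂ) ^ (-z * s) / ((Real.log q : ℝ) : ℂ) *
      ((Real.pi : ℂ) / Complex.sin ((Real.pi : ℂ) * s))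

/-!
Write `q = exp ℓ` with `ℓ < 0`, so that `q → 1` means `ℓ → 0⁻`.

*Continuation in `s` for fixed `q`.* Expanding `(1 - q ^ (k + z)) ^ (-s)` by the binomial series and
summing over `k` first turns the `q`-Hurwitz series into a prefactor times
`∑ (s)_r / r! * q ^ (z r) / (1 - q ^ (s + r))` (`qSeries`), which is meromorphic in `s` with poles
only where `q ^ (s + r) = 1`. At `s = -m` only the term `r = m` is singular, and its residue is
cancelled by that of `π / (log q * sin (π s))` (`tendsto_mul_correctedSeries`).

*The limit at nonintegers.* For `1 < re s` dominated convergence gives the Hurwitz series, and the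
correction is `O((1 - q) ^ (s - 1))`. The remaining `s` are reached by descending in unit steps. The
corrected function satisfies two identities. Its `z`-derivative is a multiple of the same function
at `s + 1` (`hasDerivAt_balancedSeries`). Its integral over `z + [0, 1]` against `q ^ (s x)`
telescopes to `π / sin (π s)` minus an incomplete beta function at `q ^ z`, up to a factor that is
singular as `q → 1`. One integration by parts combines them into a recursion from `s + 1` to `s`
(`balancedSeries_recursion`). The point of the correction term is the reflection formula
`betaSeries_reflection`: it turns the difference just mentioned into an incomplete beta function at
`1 - q ^ z`, whose leading power compensates the singular factor. So the recursion passes to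
the limit (`tendsto_correctedSeries_of_add_one`), provided the convergence is joint in
`(ℓ, s, z)`, which makes the integrals converge.

*The Hurwitz zeta function.* The limit recursion
`ζ(s, z) = z ^ (1 - s) / (s - 1) + s ∫₀¹ (1 - x) ζ(s + 1, z + x) dx` defines the continuation of the
Hurwitz series (`hurwitzAux`, `hurwitzEntire`). That the functions obtained after different numbers
of steps agree follows from uniqueness of limits.

*The points `s = -m`.* By Cauchy's formula the value removing the singularity is an integral over a
circle around `-m`. The circle avoids the integers, so the integrand converges there uniformly
(`tendsto_removedValue_of_ell`).
-/

/-! ### Binomial coefficients and power series in the unit disc -/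

/-- The coefficient `(s)_r / r!` of `t ^ r` in the Taylor expansion of `(1 - t) ^ (-s)`, where
`(s)_r` is the rising factorial. -/
noncomputable def risingCoeff (s : ℂ) (r : ℕ) : ℂ := ∏ i ∈ Finset.range r, (s + i) / (i + 1)

@[simp] lemma risingCoeff_zero (s : ℂ) : risingCoeff s 0 = 1 := by simp [risingCoeff]

lemma risingCoeff_succ (s : ℂ) (r : ℕ) :
    risingCoeff s (r + 1) = risingCoeff s r * ((s + r) / (r + 1)) := by
  simp only [risingCoeff, Finset.prod_range_succ]

lemma succ_mul_risingCoeff_succ (s : ℂ) (r : ℕ) :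
    (r + 1) * risingCoeff s (r + 1) = s * risingCoeff (s + 1) r := by
  induction r with
  | zero => simp [risingCoeff]
  | succ r ih =>
    have h1 : (r : ℂ) + 1 ≠ 0 := Nat.cast_add_one_ne_zero r
    have h2 : (r : ℂ) + 1 + 1 ≠ 0 := by exact_mod_cast Nat.cast_add_one_ne_zero (R := ℂ) (r + 1)
    rw [risingCoeff_succ s (r + 1), risingCoeff_succ (s + 1) r]
    push_cast
    field_simp
    linear_combination (s + (r + 1)) * ih

lemma risingCoeff_eq_choose (s : ℂ) (r : ℕ) : risingCoeff s r = Ring.choose (s + r - 1) r := by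
  rw [Ring.choose_eq_smul, Polynomial.descPochhammer_smeval_eq_ascPochhammer,
    Polynomial.ascPochhammer_smeval_eq_eval]
  simp only [risingCoeff]
  have : s + r - 1 - r + 1 = s := by ring
  rw [this]
  clear this
  induction r with
  | zero => simp
  | succ r ih =>
    have h1 : (r : ℂ) + 1 ≠ 0 := Nat.cast_add_one_ne_zero r
    have h3 : (Nat.factorial r : ℂ) ≠ 0 := by exact_mod_cast Nat.factorial_ne_zero r
    rw [Finset.prod_range_succ, ih, ascPochhammer_succ_eval, Nat.factorial_succ]
    simp only [smul_eq_mul]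
    push_cast
    field_simp

/-- The binomial series of `(1 - t) ^ (-s)`. -/
lemma hasSum_risingCoeff (s : ℂ) {t : ℂ} (ht : ‖t‖ < 1) :
    HasSum (fun r => risingCoeff s r * t ^ r) ((1 - t) ^ (-s)) := by
  have h := (Complex.one_div_one_sub_cpow_hasFPowerSeriesOnBall_zero s).hasSum (y := t)
    (by rw [Metric.mem_eball, edist_zero_right, ← ofReal_norm, ENNReal.ofReal_lt_one]; exact ht)
  simpa [risingCoeff_eq_choose, Complex.cpow_neg, mul_comm] using h

/-- On the disc of radius `R` the coefficients are majorized by their values at `R`. -/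
lemma norm_risingCoeff_le {s : ℂ} {R : ℝ} (h : ‖s‖ ≤ R) (r : ℕ) :
    ‖risingCoeff s r‖ ≤ ‖risingCoeff (R : ℂ) r‖ := by
  have hR : 0 ≤ R := (norm_nonneg s).trans h
  simp only [risingCoeff, norm_prod, norm_div]
  refine Finset.prod_le_prod (fun _ _ => by positivity) fun i _ => ?_
  gcongr
  calc ‖s + i‖ ≤ ‖s‖ + ‖(i : ℂ)‖ := norm_add_le _ _
    _ ≤ R + i := by simpa using h
    _ = ‖(R : ℂ) + i‖ := by
      rw [← Complex.ofReal_natCast, ← Complex.ofReal_add, Complex.norm_real, Real.norm_eq_abs,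
        abs_of_nonneg (by positivity)]

/-- The sequence `c` is the coefficient sequence of a power series which converges absolutely in
the open unit disc. -/
def DiscSummable (c : ℕ → ℂ) : Prop := ∀ ρ : ℝ, 0 ≤ ρ → ρ < 1 → Summable fun r => ‖c r‖ * ρ ^ r

lemma discSummable_risingCoeff (s : ℂ) : DiscSummable (risingCoeff s) := by
  intro ρ h0 h1
  have h := (hasSum_risingCoeff s (t := (ρ : ℂ))
    (by rwa [Complex.norm_real, Real.norm_eq_abs, abs_of_nonneg h0])).summable.norm
  simpa [abs_of_nonneg h0] using h

lemma DiscSummable.mul_bounded {c d : ℕ → ℂ} (hc : DiscSummable c) {C : ℝ}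
    (hd : ∀ r, ‖d r‖ ≤ C) : DiscSummable fun r => c r * d r := by
  intro ρ h0 h1
  refine Summable.of_nonneg_of_le (fun r => by positivity) (fun r => ?_)
    ((hc ρ h0 h1).mul_left C)
  rw [norm_mul]
  have : ‖c r‖ * ‖d r‖ * ρ ^ r ≤ ‖c r‖ * C * ρ ^ r := by gcongr; exact hd r
  linarith

lemma DiscSummable.mul_tendsto {c d : ℕ → ℂ} (hc : DiscSummable c) {a : ℂ}
    (hd : Tendsto d atTop (𝓝 a)) : DiscSummable fun r => c r * d r := by
  obtain ⟨C, hC⟩ := (Metric.isBounded_range_of_tendsto d hd).exists_norm_le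
  exact hc.mul_bounded fun r => hC _ ⟨r, rfl⟩

lemma DiscSummable.summable {c : ℕ → ℂ} (hc : DiscSummable c) {t : ℂ} (ht : ‖t‖ < 1) :
    Summable fun r => c r * t ^ r := by
  refine Summable.of_norm ?_
  simpa using hc ‖t‖ (norm_nonneg t) ht

/-- Termwise differentiation of a power series in the unit disc. -/
lemma DiscSummable.hasDerivAt {c : ℕ → ℂ} (hc : DiscSummable c) {t : ℂ} (ht : ‖t‖ < 1) :
    HasDerivAt (fun t => ∑' r, c r * t ^ r) (∑' r : ℕ, c (r + 1) * (r + 1) * t ^ r) t ∧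
      Summable (fun r : ℕ => c (r + 1) * (r + 1) * t ^ r) := by
  obtain ⟨ρ, h1, h2⟩ := exists_between ht
  have h0 : 0 ≤ ρ := (norm_nonneg t).trans h1.le
  have hf : ∀ r : ℕ, DifferentiableOn ℂ (fun t : ℂ => c r * t ^ r) (Metric.ball 0 ρ) :=
    fun r => by fun_prop
  have hle : ∀ (r : ℕ) (w : ℂ), w ∈ Metric.ball (0 : ℂ) ρ → ‖c r * w ^ r‖ ≤ ‖c r‖ * ρ ^ r := by
    intro r w hw
    rw [norm_mul, norm_pow]
    have : ‖w‖ ≤ ρ := by simpa using (mem_ball_zero_iff.1 hw).le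
    gcongr
  have hmem : t ∈ Metric.ball (0 : ℂ) ρ := by simpa using h1
  have hd := Complex.hasSum_deriv_of_summable_norm (hc ρ h0 h2) hf Metric.isOpen_ball hle hmem
  have hD := Complex.differentiableOn_tsum_of_summable_norm (hc ρ h0 h2) hf Metric.isOpen_ball hle
  have hDt := (hD.differentiableAt (Metric.isOpen_ball.mem_nhds hmem)).hasDerivAt
  have hd' : HasSum (fun r : ℕ => c (r + 1) * (r + 1) * t ^ r)
      (deriv (fun w => ∑' r, c r * w ^ r) t) := by
    rw [← hasSum_nat_add_iff' 1] at hd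
    simpa [deriv_const_mul_field, mul_assoc] using hd
  rw [hd'.tsum_eq]
  exact ⟨hDt, hd'.summable⟩

/-- The Euler operator `s + t d/dt` acts on power series by `c r ↦ c r * (s + r)`. -/
lemma DiscSummable.hasSum_mul_add {c : ℕ → ℂ} (hc : DiscSummable c) (s : ℂ) {t : ℂ}
    (ht : ‖t‖ < 1) :
    HasSum (fun r : ℕ => c r * (s + r) * t ^ r)
      (s * (∑' r, c r * t ^ r) + t * ∑' r : ℕ, c (r + 1) * (r + 1) * t ^ r) := by
  have hs := (hc.hasDerivAt ht).2
  have h2 : HasSum (fun r : ℕ => c r * r * t ^ r)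
      (t * ∑' r : ℕ, c (r + 1) * (r + 1) * t ^ r) := by
    rw [← hasSum_nat_add_iff' 1]
    convert! hs.hasSum.mul_left t using 1
    · funext r; push_cast; ring
    · simp
  convert! ((hc.summable ht).hasSum.mul_left s).add h2 using 1
  funext r; ring

lemma tendsto_add_natCast_inv (s : ℂ) : Tendsto (fun r : ℕ => (s + r)⁻¹) atTop (𝓝 0) :=
  tendsto_inv₀_cobounded.comp
    ((tendsto_const_add_cobounded s).comp tendsto_natCast_atTop_cobounded)

lemma tendsto_one_sub_exp_inv {ℓ : ℝ} (hℓ : ℓ < 0) (s : ℂ) :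
    Tendsto (fun r : ℕ => (1 - Complex.exp (ℓ * (s + r)))⁻¹) atTop (𝓝 1) := by
  have h : Tendsto (fun r : ℕ => Complex.exp (ℓ * (s + r))) atTop (𝓝 0) := by
    rw [tendsto_zero_iff_norm_tendsto_zero]
    simp only [Complex.norm_exp]
    have : Tendsto (fun r : ℕ => ℓ * (s.re + r)) atTop atBot :=
      Tendsto.const_mul_atTop_of_neg hℓ
        (tendsto_atTop_add_const_left _ _ tendsto_natCast_atTop_atTop)
    refine (Real.tendsto_exp_atBot.comp this).congr fun r => ?_
    simp
  simpa using (tendsto_const_nhds (x := (1 : ℂ)).sub h).inv₀ (by simp)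

/-- Termwise differentiation in `z` of `∑ c r * exp (ℓ * (s + r) * z)`. -/
lemma DiscSummable.hasDerivAt_exp {c : ℕ → ℂ} (hc : DiscSummable c) {ℓ : ℝ} (hℓ : ℓ < 0) (s : ℂ)
    {z : ℂ} (hz : 0 < z.re) :
    HasDerivAt (fun z => Complex.exp (ℓ * s * z) * ∑' r, c r * Complex.exp (ℓ * z) ^ r)
      (Complex.exp (ℓ * s * z) * ∑' r, c r * (ℓ * (s + r)) * Complex.exp (ℓ * z) ^ r) z := by
  have ht : ‖Complex.exp (ℓ * z)‖ < 1 := by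
    rw [Complex.norm_exp]; simpa using mul_neg_of_neg_of_pos hℓ hz
  obtain ⟨hd, hs⟩ := hc.hasDerivAt ht
  have he : HasDerivAt (fun z : ℂ => Complex.exp (ℓ * z)) (Complex.exp (ℓ * z) * ℓ) z := by
    simpa using ((hasDerivAt_id z).const_mul (ℓ : ℂ)).cexp
  have he' : HasDerivAt (fun z : ℂ => Complex.exp (ℓ * s * z))
      (Complex.exp (ℓ * s * z) * (ℓ * s)) z := by
    simpa using ((hasDerivAt_id z).const_mul (ℓ * s : ℂ)).cexp
  have h := he'.mul (hd.comp z he)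
  refine h.congr_deriv ?_
  have h3 : HasSum (fun r : ℕ => c r * (ℓ * (s + r)) * Complex.exp (ℓ * z) ^ r) _ :=
    ((hc.hasSum_mul_add s ht).mul_left (ℓ : ℂ)).congr_fun fun r => by ring
  rw [h3.tsum_eq]
  simp only [Function.comp_def]
  ring

/-! ### The incomplete beta function and its reflection formula -/

lemma tendsto_norm_add_natCast {α : Type*} {l : Filter α} {f : α → ℂ} {s : ℂ}
    (hf : Tendsto f l (𝓝 s)) :
    Tendsto (fun p : α × ℕ => ‖f p.1 + p.2‖) (l ×ˢ atTop) atTop := by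
  have h1 : Tendsto (fun p : α × ℕ => (p.2 : ℝ) - (‖s‖ + 1)) (l ×ˢ atTop) atTop :=
    tendsto_atTop_add_const_right _ _ (tendsto_natCast_atTop_atTop.comp tendsto_snd)
  refine tendsto_atTop_mono' _ ?_ h1
  have h2 : ∀ᶠ a in l, ‖f a‖ ≤ ‖s‖ + 1 := by
    filter_upwards [hf.norm.eventually (gt_mem_nhds (lt_add_one ‖s‖))] with a ha using ha.le
  filter_upwards [tendsto_fst.eventually h2] with p hp
  have h3 := norm_sub_le (f p.1 + p.2) (f p.1)
  rw [add_sub_cancel_left, Complex.norm_natCast] at h3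
  linarith

lemma tendsto_exp_add_natCast {ℓ : ℝ} (hℓ : ℓ < 0) (s : ℂ) :
    Tendsto (fun p : ℂ × ℕ => Complex.exp (ℓ * (p.1 + p.2))) (𝓝 s ×ˢ atTop) (𝓝 0) := by
  rw [tendsto_zero_iff_norm_tendsto_zero]
  simp only [Complex.norm_exp]
  have h1 : Tendsto (fun p : ℂ × ℕ => p.1.re + (p.2 : ℝ)) (𝓝 s ×ˢ atTop) atTop :=
    ((Complex.continuous_re.tendsto s).comp tendsto_fst).add_atTop
      (tendsto_natCast_atTop_atTop.comp tendsto_snd)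
  refine (Real.tendsto_exp_atBot.comp (Tendsto.const_mul_atTop_of_neg hℓ h1)).congr fun r => ?_
  simp

/-- Uniformity in `r`: joint eventual validity takes care of all large `r`, and the remaining
finitely many are treated one by one. -/
lemma eventually_forall_of_prod_atTop {α : Type*} {l : Filter α} {P : α → ℕ → Prop}
    (h1 : ∀ r, ∀ᶠ a in l, P a r) (h2 : ∀ᶠ p in l ×ˢ (atTop : Filter ℕ), P p.1 p.2) :
    ∀ᶠ a in l, ∀ r, P a r := by
  rw [eventually_prod_iff] at h2
  obtain ⟨pa, hpa, pb, hpb, h⟩ := h2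
  obtain ⟨N, hN⟩ := eventually_atTop.1 hpb
  have h3 : ∀ᶠ a in l, ∀ r ∈ Finset.range N, P a r :=
    (Finset.range N).eventually_all.2 fun r _ => h1 r
  filter_upwards [hpa, h3] with a ha hN' r
  rcases lt_or_ge r N with hr | hr
  · exact hN' r (Finset.mem_range.2 hr)
  · exact h ha (hN r hr)

/-- Analytic dependence on `s` of a power series with coefficients `risingCoeff s r * d s r`. The
factors `d s r` need to be holomorphic and bounded near `s₀` uniformly only for large `r`. -/
lemma analyticAt_tsum_risingCoeff {d : ℂ → ℕ → ℂ} {s₀ : ℂ} {C : ℝ} {t : ℂ} (ht : ‖t‖ < 1)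
    (h1 : ∀ r, AnalyticAt ℂ (fun s => d s r) s₀)
    (h2 : ∀ᶠ p in 𝓝 s₀ ×ˢ (atTop : Filter ℕ),
      DifferentiableAt ℂ (fun s => d s p.2) p.1 ∧ ‖d p.1 p.2‖ ≤ C) :
    AnalyticAt ℂ (fun s => ∑' r, risingCoeff s r * d s r * t ^ r) s₀ := by
  obtain ⟨C₀, hC₀⟩ : ∃ C₀, ∀ r, ‖d s₀ r‖ ≤ C₀ := by
    have h3 : ∀ᶠ r in atTop, ‖d s₀ r‖ ≤ C := by
      obtain ⟨pa, hpa, pb, hpb, h⟩ := eventually_prod_iff.1 h2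
      filter_upwards [hpb] with r hr using (h hpa.self_of_nhds hr).2
    have h4 : BddAbove (Set.range fun r => ‖d s₀ r‖) :=
      IsBoundedUnder.bddAbove_range (isBoundedUnder_of_eventually_le h3)
    obtain ⟨C₀, hC⟩ := h4
    exact ⟨C₀, fun r => hC ⟨r, rfl⟩⟩
  have hC0 : 0 ≤ C₀ := (norm_nonneg _).trans (hC₀ 0)
  have h5 : ∀ᶠ s in 𝓝 s₀, ∀ r,
      DifferentiableAt ℂ (fun s => d s r) s ∧ ‖d s r‖ ≤ max C (C₀ + 1) := by
    refine eventually_forall_of_prod_atTop (fun r => ?_) ?_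
    · have h6 : ∀ᶠ s in 𝓝 s₀, ‖d s r‖ < C₀ + 1 :=
        (h1 r).continuousAt.norm.eventually_lt continuousAt_const (by linarith [hC₀ r])
      filter_upwards [(h1 r).eventually_analyticAt, h6] with s hs hs'
      exact ⟨hs.differentiableAt, hs'.le.trans (le_max_right _ _)⟩
    · filter_upwards [h2] with p hp using ⟨hp.1, hp.2.trans (le_max_left _ _)⟩
  have h6 : ∀ᶠ s in 𝓝 s₀, ‖s‖ ≤ ‖s₀‖ + 1 := by
    filter_upwards [(continuous_norm.tendsto s₀).eventually (gt_mem_nhds (lt_add_one ‖s₀‖))]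
      with a ha using ha.le
  obtain ⟨U, hU, hUo, hmem⟩ := eventually_nhds_iff.1 (h5.and h6)
  refine DifferentiableOn.analyticAt (s := U) ?_ (hUo.mem_nhds hmem)
  refine Complex.differentiableOn_tsum_of_summable_norm (u := fun r =>
    max C (C₀ + 1) * (‖risingCoeff ((‖s₀‖ + 1 : ℝ) : ℂ) r‖ * ‖t‖ ^ r))
    ((discSummable_risingCoeff _ _ (norm_nonneg t) ht).mul_left _) (fun r s hs => ?_) hUo
    fun r s hs => ?_
  · have h7 : DifferentiableAt ℂ (fun s => risingCoeff s r) s := by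
      unfold risingCoeff; fun_prop
    exact ((h7.mul ((hU s hs).1 r).1).mul_const _).differentiableWithinAt
  · rw [norm_mul, norm_mul, norm_pow]
    calc ‖risingCoeff s r‖ * ‖d s r‖ * ‖t‖ ^ r
        ≤ ‖risingCoeff ((‖s₀‖ + 1 : ℝ) : ℂ) r‖ * max C (C₀ + 1) * ‖t‖ ^ r := by
          gcongr
          · exact norm_risingCoeff_le (hU s hs).2 r
          · exact ((hU s hs).1 r).2
      _ = _ := by ring

/-- The power series `∑ (s)_r / (r! (s + r)) t ^ r`; multiplied by `t ^ s` it is the incomplete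
beta function `∫₀ᵗ u ^ (s - 1) (1 - u) ^ (-s) du`. -/
noncomputable def betaSeries (s t : ℂ) : ℂ := ∑' r : ℕ, risingCoeff s r * (s + r)⁻¹ * t ^ r

lemma discSummable_betaSeries (s : ℂ) : DiscSummable fun r => risingCoeff s r * (s + r)⁻¹ := by
  exact (discSummable_risingCoeff s).mul_tendsto (tendsto_add_natCast_inv s)

/-- `t ^ s * betaSeries s t` is a primitive of the integrand of the incomplete beta function. -/
lemma hasDerivAt_cpow_mul_betaSeries {s : ℂ} (hs : ∀ r : ℕ, s + r ≠ 0) {t : ℂ} (ht : ‖t‖ < 1)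
    (ht' : t ∈ Complex.slitPlane) :
    HasDerivAt (fun t => t ^ s * betaSeries s t) (t ^ (s - 1) * (1 - t) ^ (-s)) t := by
  have hc := discSummable_betaSeries s
  have h1 := (hasStrictDerivAt_id t).hasDerivAt.cpow_const (c := s) ht'
  have h := h1.mul (hc.hasDerivAt ht).1
  refine h.congr_deriv ?_
  have h2 : HasSum (fun r => risingCoeff s r * t ^ r) _ :=
    (hc.hasSum_mul_add s ht).congr_fun fun r => by field_simp [hs r]
  rw [(hasSum_risingCoeff s ht).unique h2]
  have ht0 : t ≠ 0 := Complex.slitPlane_ne_zero ht'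
  have h3 : t ^ s = t ^ (s - 1) * t := by
    rw [Complex.cpow_sub _ _ ht0, Complex.cpow_one]; field_simp
  simp only [id, h3]
  ring

lemma continuousAt_betaSeries (s : ℂ) {t : ℂ} (ht : ‖t‖ < 1) : ContinuousAt (betaSeries s) t :=
  ((discSummable_betaSeries s).hasDerivAt ht).1.continuousAt

lemma integral_eq_betaSeries {s : ℂ} (h0 : 0 < s.re) (h1 : s.re < 1) :
    IntervalIntegrable (fun u : ℝ => (u : ℂ) ^ (s - 1) * (1 - u : ℂ) ^ (-s)) MeasureTheory.volume
      0 (1 / 2) ∧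
    ∫ u in (0 : ℝ)..(1 / 2), (u : ℂ) ^ (s - 1) * (1 - u : ℂ) ^ (-s) =
      (1 / 2 : ℂ) ^ s * betaSeries s (1 / 2) := by
  have hs : ∀ r : ℕ, s + r ≠ 0 := fun r h => by
    have := congrArg Complex.re h
    simp at this
    have : (0 : ℝ) ≤ r := Nat.cast_nonneg r
    linarith
  have hint : IntervalIntegrable (fun u : ℝ => (u : ℂ) ^ (s - 1) * (1 - u : ℂ) ^ (-s))
      MeasureTheory.volume 0 (1 / 2) := by
    simpa using Complex.betaIntegral_convergent_left h0 (1 - s)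
  refine ⟨hint, ?_⟩
  have hs0 : s ≠ 0 := by simpa using hs 0
  have key := intervalIntegral.integral_eq_sub_of_hasDerivAt_of_le (a := 0) (b := 1 / 2)
    (f := fun u : ℝ => (u : ℂ) ^ s * betaSeries s u) (by norm_num) ?_ ?_ hint
  · rw [key]
    simp [Complex.zero_cpow hs0]
  · intro u hu
    have hu1 : ‖(u : ℂ)‖ < 1 := by
      rw [Complex.norm_real, Real.norm_eq_abs, abs_of_nonneg hu.1]; linarith [hu.2]
    have c1 : ContinuousAt (fun u : ℝ => (u : ℂ) ^ s) u :=
      Complex.continuousAt_ofReal_cpow_const u s (Or.inl h0)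
    exact (c1.mul ((continuousAt_betaSeries s hu1).comp
      Complex.continuous_ofReal.continuousAt)).continuousWithinAt
  · intro u hu
    have hu1 : ‖(u : ℂ)‖ < 1 := by
      rw [Complex.norm_real, Real.norm_eq_abs, abs_of_nonneg hu.1.le]; linarith [hu.2]
    exact (hasDerivAt_cpow_mul_betaSeries hs hu1
      (Complex.ofReal_mem_slitPlane.2 hu.1)).comp_ofReal

/-- The reflection formula at `t = 1 / 2` in the strip `0 < re s < 1`: the two halves of Euler's
beta integral `B(s, 1 - s) = π / sin (π s)`. -/
lemma betaSeries_half_of_re_mem {s : ℂ} (h0 : 0 < s.re) (h1 : s.re < 1) :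
    (1 / 2 : ℂ) ^ s * betaSeries s (1 / 2) + (1 / 2 : ℂ) ^ (1 - s) * betaSeries (1 - s) (1 / 2) =
      Real.pi / Complex.sin (Real.pi * s) := by
  have h0' : 0 < (1 - s).re := by simpa using h1
  have h1' : (1 - s).re < 1 := by simpa using h0
  obtain ⟨i1, e1⟩ := integral_eq_betaSeries h0 h1
  obtain ⟨i2, e2⟩ := integral_eq_betaSeries h0' h1'
  rw [← Complex.Gamma_mul_Gamma_one_sub, Complex.Gamma_mul_Gamma_eq_betaIntegral h0 h0',
    add_sub_cancel, Complex.Gamma_one, one_mul, Complex.betaIntegral, ← e1, ← e2]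
  have hsub := intervalIntegral.integral_comp_sub_left
    (fun u : ℝ => (u : ℂ) ^ (s - 1) * (1 - u : ℂ) ^ (-s)) (a := 0) (b := 1 / 2) 1
  have e3 : (∫ u in (0 : ℝ)..(1 / 2), (u : ℂ) ^ (1 - s - 1) * (1 - u : ℂ) ^ (-(1 - s))) =
      ∫ u in (1 / 2 : ℝ)..1, (u : ℂ) ^ (s - 1) * (1 - u : ℂ) ^ (-s) := by
    norm_num at hsub
    rw [← hsub]
    refine intervalIntegral.integral_congr fun u _ => ?_
    rw [mul_comm]
    congr 2 <;> ring
  have i3 : IntervalIntegrable (fun u : ℝ => (u : ℂ) ^ (s - 1) * (1 - u : ℂ) ^ (-s))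
      MeasureTheory.volume 0 1 := by
    simpa using Complex.betaIntegral_convergent h0 h0'
  rw [e3, intervalIntegral.integral_add_adjacent_intervals i1
    (i3.mono_set (by rw [Set.uIcc_of_le, Set.uIcc_of_le]; apply Set.Icc_subset_Icc <;> norm_num
                     all_goals norm_num))]
  simp

/-- The set of complex numbers that are not integers. -/
def nonintegers : Set ℂ := {s | ∀ n : ℤ, s ≠ n}

lemma nonintegers_eq : nonintegers = (Set.range ((↑) : ℤ → ℂ))ᶜ := by
  ext s; simp [nonintegers, eq_comm]

lemma isOpen_nonintegers : IsOpen nonintegers := by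
  rw [nonintegers_eq]
  exact Complex.isClosed_range_intCast.isOpen_compl

lemma isPreconnected_nonintegers : IsPreconnected nonintegers := by
  rw [nonintegers_eq]
  exact ((Set.countable_range _).isConnected_compl_of_one_lt_rank (by simp)).isPreconnected

lemma add_natCast_ne_zero {s : ℂ} (hs : s ∈ nonintegers) (r : ℕ) : s + r ≠ 0 := fun h => by
  refine hs (-r) ?_
  push_cast
  linear_combination h

lemma one_sub_mem_nonintegers {s : ℂ} (hs : s ∈ nonintegers) : 1 - s ∈ nonintegers := fun n h => by
  refine hs (1 - n) ?_
  push_cast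
  linear_combination -h

lemma add_one_mem_nonintegers {s : ℂ} (hs : s ∈ nonintegers) : s + 1 ∈ nonintegers := fun n h => by
  refine hs (n - 1) ?_
  push_cast
  linear_combination h

lemma sin_pi_mul_ne_zero_of_mem {s : ℂ} (hs : s ∈ nonintegers) : Complex.sin (Real.pi * s) ≠ 0 := by
  rw [Complex.sin_ne_zero_iff]
  intro k hk
  refine hs k ?_
  have : (Real.pi : ℂ) ≠ 0 := by exact_mod_cast Real.pi_ne_zero
  apply mul_left_cancel₀ this
  rw [hk]; ring

lemma analyticAt_betaSeries {s : ℂ} (hs : ∀ r : ℕ, s + r ≠ 0) {t : ℂ} (ht : ‖t‖ < 1) :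
    AnalyticAt ℂ (fun s => betaSeries s t) s := by
  refine analyticAt_tsum_risingCoeff (C := 1) ht (fun r => ?_) ?_
  · exact (analyticAt_id.add analyticAt_const).inv (hs r)
  · filter_upwards [(tendsto_norm_add_natCast (tendsto_id (x := 𝓝 s))).eventually_ge_atTop 1]
      with p hp
    simp only [id] at hp
    have h0 : p.1 + p.2 ≠ 0 := norm_pos_iff.1 (by linarith)
    refine ⟨(differentiableAt_id.add_const _).inv h0, ?_⟩
    rw [norm_inv]
    exact inv_le_one_of_one_le₀ hp

/-- Reflection formula for the incomplete beta function. -/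
lemma betaSeries_reflection {s : ℂ} (hs : s ∈ nonintegers) {t : ℂ} (ht : ‖t‖ < 1)
    (ht' : ‖1 - t‖ < 1) :
    t ^ s * betaSeries s t + (1 - t) ^ (1 - s) * betaSeries (1 - s) (1 - t) =
      Real.pi / Complex.sin (Real.pi * s) := by
  -- Independence of `t`: the two summands have opposite derivatives.
  have hU : IsOpen (Metric.ball (0 : ℂ) 1 ∩ Metric.ball 1 1) :=
    Metric.isOpen_ball.inter Metric.isOpen_ball
  have hUc : IsPreconnected (Metric.ball (0 : ℂ) 1 ∩ Metric.ball 1 1) :=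
    ((convex_ball _ _).inter (convex_ball _ _)).isPreconnected
  have hmem : ∀ u : ℂ, u ∈ Metric.ball (0 : ℂ) 1 ∩ Metric.ball 1 1 ↔ ‖u‖ < 1 ∧ ‖1 - u‖ < 1 := by
    intro u; simp [dist_eq_norm, norm_sub_rev]
  have hslit : ∀ u : ℂ, ‖1 - u‖ < 1 → u ∈ Complex.slitPlane := by
    intro u hu
    left
    have := (Complex.re_le_norm (1 - u)).trans_lt hu
    simp at this
    exact this
  have hd : ∀ u ∈ Metric.ball (0 : ℂ) 1 ∩ Metric.ball 1 1,
      HasDerivAt (fun t : ℂ => t ^ s * betaSeries s t +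
        (1 - t) ^ (1 - s) * betaSeries (1 - s) (1 - t)) 0 u := by
    intro u hu
    rw [hmem] at hu
    have d1 := hasDerivAt_cpow_mul_betaSeries (add_natCast_ne_zero hs) hu.1 (hslit u hu.2)
    have d2 := hasDerivAt_cpow_mul_betaSeries
      (add_natCast_ne_zero (one_sub_mem_nonintegers hs)) hu.2 (hslit (1 - u) (by simpa using hu.1))
    have d3 := d2.comp u ((hasDerivAt_id u).const_sub 1)
    refine (d1.add d3).congr_deriv ?_
    rw [show (1 : ℂ) - s - 1 = -s by ring, show -(1 - s) = s - 1 by ring, sub_sub_cancel]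
    ring
  have hhalf : ‖(1 / 2 : ℂ)‖ < 1 := by norm_num
  have h1 := hU.eqOn_of_deriv_eq hUc (f := fun t : ℂ => t ^ s * betaSeries s t +
        (1 - t) ^ (1 - s) * betaSeries (1 - s) (1 - t))
    (g := fun _ => (1 / 2 : ℂ) ^ s * betaSeries s (1 / 2) +
        (1 / 2 : ℂ) ^ (1 - s) * betaSeries (1 - s) (1 / 2))
    (fun u hu => (hd u hu).differentiableAt.differentiableWithinAt)
    (differentiableOn_const _) (fun u hu => by simp [(hd u hu).deriv]) (x := 1 / 2)
    ((hmem _).2 ⟨hhalf, by norm_num⟩) (by norm_num)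
  refine (h1 ((hmem t).2 ⟨ht, ht'⟩)).trans ?_
  -- At `t = 1 / 2` both sides are analytic in `s`, and agree on the strip `0 < re s < 1`.
  have a1 : ∀ s ∈ nonintegers, AnalyticAt ℂ (fun s => (1 / 2 : ℂ) ^ s * betaSeries s (1 / 2)) s :=
    fun s hs => (analyticAt_const.cpow analyticAt_id (by left; norm_num)).mul
      (analyticAt_betaSeries (add_natCast_ne_zero hs) hhalf)
  have a2 : AnalyticOnNhd ℂ (fun s => (1 / 2 : ℂ) ^ s * betaSeries s (1 / 2) +
      (1 / 2 : ℂ) ^ (1 - s) * betaSeries (1 - s) (1 / 2)) nonintegers := fun s hs =>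
    (a1 s hs).add ((a1 (1 - s) (one_sub_mem_nonintegers hs)).comp_of_eq
      (analyticAt_const.sub analyticAt_id) rfl)
  have a3 : AnalyticOnNhd ℂ (fun s => (Real.pi : ℂ) / Complex.sin (Real.pi * s)) nonintegers :=
    fun s hs => analyticAt_const.div
      (by fun_prop) (sin_pi_mul_ne_zero_of_mem hs)
  have hstrip : ∀ᶠ s : ℂ in 𝓝 (1 / 2), 0 < s.re ∧ s.re < 1 :=
    (Complex.continuous_re.continuousAt.eventually_const_lt (by norm_num)).and
      (Complex.continuous_re.continuousAt.eventually_lt_const (by norm_num))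
  refine a2.eqOn_of_preconnected_of_eventuallyEq a3 isPreconnected_nonintegers (z₀ := 1 / 2)
    (fun n hn => ?_) ?_ hs
  · have h2 : (2 * n : ℤ) = 1 := by
      have : (2 : ℂ) * n = 1 := by rw [← hn]; norm_num
      exact_mod_cast this
    omega
  · filter_upwards [hstrip] with s hs
    exact betaSeries_half_of_re_mem hs.1 hs.2

/-! ### The power series in `q ^ z` and its recursion in `s` -/

/-- The entire function `(exp u - 1) / u`, with value `1` at `u = 0`. -/
noncomputable def expSlope (u : ℂ) : ℂ := dslope Complex.exp 0 u

lemma expSlope_zero : expSlope 0 = 1 := by simp [expSlope]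

lemma mul_expSlope (u : ℂ) : u * expSlope u = Complex.exp u - 1 := by
  simpa [expSlope] using sub_smul_dslope Complex.exp 0 u

lemma continuous_expSlope : Continuous expSlope := by
  have : Differentiable ℂ (dslope Complex.exp 0) := fun u =>
    ((Complex.differentiableOn_dslope (s := Set.univ) Filter.univ_mem).2
      Complex.differentiable_exp.differentiableOn).differentiableAt Filter.univ_mem
  exact this.continuous

/-- The power series `∑ (s)_r / r! * t ^ r / (1 - q ^ (s + r))` with `q = exp ℓ`. -/
noncomputable def qSeries (ℓ : ℝ) (s t : ℂ) : ℂ :=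
  ∑' r : ℕ, risingCoeff s r * (1 - Complex.exp (ℓ * (s + r)))⁻¹ * t ^ r

lemma discSummable_qSeries {ℓ : ℝ} (hℓ : ℓ < 0) (s : ℂ) :
    DiscSummable fun r => risingCoeff s r * (1 - Complex.exp (ℓ * (s + r)))⁻¹ :=
  (discSummable_risingCoeff s).mul_tendsto (tendsto_one_sub_exp_inv hℓ s)

lemma norm_exp_mul_lt_one {ℓ : ℝ} (hℓ : ℓ < 0) {z : ℂ} (hz : 0 < z.re) :
    ‖Complex.exp (ℓ * z)‖ < 1 := by
  rw [Complex.norm_exp]; simpa using mul_neg_of_neg_of_pos hℓ hz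

/-- The function `∑ q ^ (s k) (1 - q ^ (k + z)) ^ (-s) + q ^ (-s z) π / (log q sin (π s))`,
continued to all `s`, with `q = exp ℓ`. -/
noncomputable def balancedSeries (ℓ : ℝ) (s z : ℂ) : ℂ :=
  qSeries ℓ s (Complex.exp (ℓ * z)) +
    Complex.exp (-(ℓ * s * z)) * (Real.pi / (ℓ * Complex.sin (Real.pi * s)))

lemma sin_pi_mul_add_one (s : ℂ) :
    Complex.sin (Real.pi * (s + 1)) = -Complex.sin (Real.pi * s) := by
  rw [mul_add, mul_one, Complex.sin_add_pi]

/-- The `z`-derivative shifts `s` by one, as for the classical Hurwitz zeta function. -/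
lemma hasDerivAt_balancedSeries {ℓ : ℝ} (hℓ : ℓ < 0) (s : ℂ) {z : ℂ} (hz : 0 < z.re) :
    HasDerivAt (balancedSeries ℓ s)
      (s * ℓ * Complex.exp (ℓ * z) * balancedSeries ℓ (s + 1) z) z := by
  have ht := norm_exp_mul_lt_one hℓ hz
  have he : HasDerivAt (fun z : ℂ => Complex.exp (ℓ * z)) (Complex.exp (ℓ * z) * ℓ) z := by
    simpa using ((hasDerivAt_id z).const_mul (ℓ : ℂ)).cexp
  have he' : HasDerivAt (fun z : ℂ => Complex.exp (-(ℓ * s * z)))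
      (Complex.exp (-(ℓ * s * z)) * -(ℓ * s)) z := by
    simpa using ((hasDerivAt_id z).const_mul (ℓ * s : ℂ)).neg.cexp
  have h := (((discSummable_qSeries hℓ s).hasDerivAt ht).1.comp z he).add
    (he'.mul_const (Real.pi / (ℓ * Complex.sin (Real.pi * s))))
  refine h.congr_deriv ?_
  have h1 : ∀ r : ℕ, risingCoeff s (r + 1) * (1 - Complex.exp (ℓ * (s + (r + 1 : ℕ))))⁻¹ *
      (r + 1) * Complex.exp (ℓ * z) ^ r = s * (risingCoeff (s + 1) r *
        (1 - Complex.exp (ℓ * (s + 1 + r)))⁻¹ * Complex.exp (ℓ * z) ^ r) := by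
    intro r
    have h2 := succ_mul_risingCoeff_succ s r
    rw [show s + 1 + (r : ℂ) = s + (r + 1 : ℕ) by push_cast; ring]
    linear_combination (1 - Complex.exp (ℓ * (s + (r + 1 : ℕ))))⁻¹ *
      Complex.exp (ℓ * z) ^ r * h2
  have h3 : Complex.exp (-(ℓ * s * z)) =
      Complex.exp (ℓ * z) * Complex.exp (-(ℓ * (s + 1) * z)) := by
    rw [← Complex.exp_add]; ring_nf
  have h4 : (Real.pi : ℂ) / (ℓ * -Complex.sin (Real.pi * s)) =
      -(Real.pi / (ℓ * Complex.sin (Real.pi * s))) := by rw [mul_neg, div_neg]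
  rw [tsum_congr h1, tsum_mul_left, balancedSeries, sin_pi_mul_add_one, ← qSeries, h3, h4]
  ring

/-- The recursion expressing the function at `s` through an explicit term and the function at
`s + 1`. It comes from integrating `exp (ℓ * s * x)` times the function over `z + [0, 1]`, where
the series telescopes, and from one integration by parts. -/
lemma balancedSeries_recursion {ℓ : ℝ} (hℓ : ℓ < 0) {s : ℂ} (hs : s ∈ nonintegers)
    (hp : ∀ r : ℕ, Complex.exp (ℓ * (s + r)) ≠ 1) {z : ℂ} (hz : 0 < z.re) :
    expSlope (ℓ * s) * balancedSeries ℓ s z =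
      Complex.exp (-(ℓ * s * z)) * ((Real.pi / Complex.sin (Real.pi * s) -
        Complex.exp (ℓ * s * z) * betaSeries s (Complex.exp (ℓ * z))) / ℓ) -
      s * ∫ x in (0 : ℝ)..1, (1 - x) * Complex.exp (ℓ * s * x) * expSlope (ℓ * s * (1 - x)) *
        (ℓ * Complex.exp (ℓ * (z + x)) * balancedSeries ℓ (s + 1) (z + x)) := by
  have hℓ0 : (ℓ : ℂ) ≠ 0 := by exact_mod_cast hℓ.ne
  have hs0 : s ≠ 0 := by simpa using add_natCast_ne_zero hs 0
  have hsin := sin_pi_mul_ne_zero_of_mem hs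
  have hsub : ∀ r : ℕ, 1 - Complex.exp (ℓ * (s + r)) ≠ 0 := fun r => sub_ne_zero.2 (hp r).symm
  set φ : ℝ → ℂ := fun x => (Complex.exp (ℓ * s) - Complex.exp (ℓ * s * x)) / (ℓ * s) with hφ
  have hφE : ∀ x : ℝ, (1 - x) * Complex.exp (ℓ * s * x) * expSlope (ℓ * s * (1 - x)) = φ x := by
    intro x
    have h := mul_expSlope (ℓ * s * (1 - x))
    have h2 : Complex.exp (ℓ * s) = Complex.exp (ℓ * s * x) * Complex.exp (ℓ * s * (1 - x)) := by
      rw [← Complex.exp_add]; ring_nf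
    simp only [hφ]
    rw [eq_div_iff (mul_ne_zero hℓ0 hs0), h2]
    linear_combination Complex.exp (ℓ * s * x) * h
  have hzx : ∀ x ∈ Set.uIcc (0 : ℝ) 1, 0 < (z + x).re := by
    intro x hx
    rw [Set.uIcc_of_le zero_le_one] at hx
    simpa using add_pos_of_pos_of_nonneg hz hx.1
  -- a primitive of `exp (ℓ * s * y) * balancedSeries ℓ s y`
  set c : ℕ → ℂ := fun r => risingCoeff s r * (1 - Complex.exp (ℓ * (s + r)))⁻¹ * (s + r)⁻¹
  have hc : DiscSummable c := (discSummable_qSeries hℓ s).mul_tendsto (tendsto_add_natCast_inv s)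
  set Q : ℂ → ℂ := fun y => Complex.exp (ℓ * s * y) * (∑' r, c r * Complex.exp (ℓ * y) ^ r) / ℓ +
    y * (Real.pi / (ℓ * Complex.sin (Real.pi * s))) with hQ
  have hQd : ∀ y : ℂ, 0 < y.re →
      HasDerivAt Q (Complex.exp (ℓ * s * y) * balancedSeries ℓ s y) y := by
    intro y hy
    have h := ((hc.hasDerivAt_exp hℓ s hy).div_const (ℓ : ℂ)).add
      ((hasDerivAt_id y).mul_const (Real.pi / (ℓ * Complex.sin (Real.pi * s)) : ℂ))
    refine h.congr_deriv ?_
    have h1 : ∀ r : ℕ, c r * (ℓ * (s + r)) * Complex.exp (ℓ * y) ^ r =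
        ℓ * (risingCoeff s r * (1 - Complex.exp (ℓ * (s + r)))⁻¹ * Complex.exp (ℓ * y) ^ r) := by
      intro r
      have := add_natCast_ne_zero hs r
      simp only [c]
      field_simp
    have h2 : Complex.exp (ℓ * s * y) * Complex.exp (-(ℓ * s * y)) = 1 := by
      rw [← Complex.exp_add]; simp
    rw [tsum_congr h1, tsum_mul_left, ← qSeries, balancedSeries, mul_add, one_mul,
      ← mul_assoc _ (Complex.exp (-(ℓ * s * y))), h2]
    field_simp
  have hQdiff : Q (z + 1) - Q z = (Real.pi / Complex.sin (Real.pi * s) -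
      Complex.exp (ℓ * s * z) * betaSeries s (Complex.exp (ℓ * z))) / ℓ := by
    have hz1 : 0 < (z + 1).re := by simpa using add_pos hz one_pos
    have s1 := (hc.summable (norm_exp_mul_lt_one hℓ hz1)).mul_left (Complex.exp (ℓ * s))
    have s2 := hc.summable (norm_exp_mul_lt_one hℓ hz)
    have h1 : Complex.exp (ℓ * s) * (∑' r, c r * Complex.exp (ℓ * (z + 1)) ^ r) -
        ∑' r, c r * Complex.exp (ℓ * z) ^ r = -betaSeries s (Complex.exp (ℓ * z)) := by
      rw [← tsum_mul_left, ← s1.tsum_sub s2, betaSeries, ← tsum_neg]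
      refine tsum_congr fun r => ?_
      have h2 : Complex.exp (ℓ * (s + r)) = Complex.exp (ℓ * s) * Complex.exp ℓ ^ r := by
        rw [← Complex.exp_nat_mul, ← Complex.exp_add]; ring_nf
      have h3 := hsub r
      have h4 := add_natCast_ne_zero hs r
      have h5 : Complex.exp (ℓ * (z + 1)) ^ r = Complex.exp (ℓ * z) ^ r * Complex.exp ℓ ^ r := by
        rw [← mul_pow, ← Complex.exp_add]; ring_nf
      simp only [c]
      rw [h5]
      field_simp
      rw [h2]
      ring
    have h6 : Complex.exp (ℓ * s * (z + 1)) = Complex.exp (ℓ * s * z) * Complex.exp (ℓ * s) := by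
      rw [← Complex.exp_add]; ring_nf
    simp only [hQ]
    rw [h6]
    field_simp
    linear_combination Complex.exp (ℓ * s * z) * h1
  have hφd : ∀ x : ℝ, HasDerivAt φ (-Complex.exp (ℓ * s * x)) x := by
    intro x
    have h := (((hasDerivAt_id (x : ℂ)).const_mul (ℓ * s : ℂ)).cexp.const_sub
      (Complex.exp (ℓ * s))).div_const (ℓ * s : ℂ)
    refine (h.comp_ofReal).congr_deriv ?_
    simp only [id]
    field_simp
  have hshift : ∀ {f : ℂ → ℂ} {f' : ℂ} {x : ℝ}, HasDerivAt f f' (z + x) →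
      HasDerivAt (fun x : ℝ => f (z + x)) f' x := by
    intro f f' x h
    have h2 : HasDerivAt (fun w : ℂ => z + w) 1 (x : ℂ) := (hasDerivAt_id _).const_add z
    simpa using (HasDerivAt.comp (x : ℂ) h h2).comp_ofReal
  have hftc := intervalIntegral.integral_eq_sub_of_hasDerivAt (a := 0) (b := 1)
    (f := fun x : ℝ => φ x * balancedSeries ℓ s (z + x) + Complex.exp (-(ℓ * s * z)) * Q (z + x))
    (f' := fun x : ℝ => s * (φ x *
      (ℓ * Complex.exp (ℓ * (z + x)) * balancedSeries ℓ (s + 1) (z + x)))) ?_ ?_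
  · rw [intervalIntegral.integral_const_mul] at hftc
    simp only [hφE]
    rw [hftc, ← hQdiff]
    have e0 : φ 0 = expSlope (ℓ * s) := by rw [← hφE 0]; simp
    have e1 : φ 1 = 0 := by simp [hφ]
    simp only [e0, e1, Complex.ofReal_zero, Complex.ofReal_one, add_zero]
    ring
  · intro x hx
    have h1 := (hφd x).mul (hshift (hasDerivAt_balancedSeries hℓ s (hzx x hx)))
    have h2 := (hshift (hQd _ (hzx x hx))).const_mul (Complex.exp (-(ℓ * s * z)))
    refine (h1.add h2).congr_deriv ?_
    have h3 : Complex.exp (-(ℓ * s * z)) * Complex.exp (ℓ * s * (z + x)) =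
        Complex.exp (ℓ * s * x) := by
      rw [← Complex.exp_add]; ring_nf
    linear_combination balancedSeries ℓ s (z + x) * h3
  · refine ContinuousOn.intervalIntegrable ?_
    have c1 : ContinuousOn (fun x : ℝ => balancedSeries ℓ (s + 1) (z + x)) (Set.uIcc 0 1) :=
      fun x hx => (hshift (hasDerivAt_balancedSeries hℓ (s + 1)
        (hzx x hx))).continuousAt.continuousWithinAt
    have c2 : Continuous φ := by fun_prop
    exact continuousOn_const.mul (c2.continuousOn.mul
      ((by fun_prop : Continuous fun x : ℝ => (ℓ : ℂ) * Complex.exp (ℓ * (z + x))).continuousOn.mul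
        c1))

/-! ### Parametric limits, and `q`-numbers as `q → 1` -/

/-- Convergence of parametric integrals over a compact interval when the integrands converge
continuously, that is, jointly in the parameter and the variable. -/
lemma tendsto_intervalIntegral_of_tendsto_prod {α : Type*} {l : Filter α} [l.IsCountablyGenerated]
    {F : α → ℝ → ℂ} {G : ℝ → ℂ} {a b : ℝ} (hab : a ≤ b)
    (hF : ∀ x ∈ Set.Icc a b,
      Tendsto (fun p : α × ℝ => F p.1 p.2) (l ×ˢ 𝓝[Set.Icc a b] x) (𝓝 (G x)))
    (hm : ∀ᶠ i in l, ContinuousOn (F i) (Set.Icc a b)) :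
    Tendsto (fun i => ∫ x in a..b, F i x) l (𝓝 (∫ x in a..b, G x)) := by
  have hbound : ∃ M : ℝ, ∀ᶠ i in l, ∀ x ∈ Set.Icc a b, ‖F i x‖ ≤ M := by
    refine isCompact_Icc.induction_on (p := fun S => ∃ M : ℝ, ∀ᶠ i in l, ∀ x ∈ S, ‖F i x‖ ≤ M)
      ⟨0, by simp⟩ ?_ ?_ ?_
    · rintro S T hST ⟨M, hM⟩
      exact ⟨M, hM.mono fun i hi x hx => hi x (hST hx)⟩
    · rintro S T ⟨M, hM⟩ ⟨N, hN⟩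
      refine ⟨max M N, ?_⟩
      filter_upwards [hM, hN] with i h1 h2 x hx
      rcases hx with hx | hx
      · exact (h1 x hx).trans (le_max_left _ _)
      · exact (h2 x hx).trans (le_max_right _ _)
    · intro x hx
      have h := (hF x hx).norm.eventually_le_const (lt_add_one ‖G x‖)
      obtain ⟨pa, hpa, pb, hpb, hp⟩ := eventually_prod_iff.1 h
      exact ⟨{y | pb y}, hpb, ‖G x‖ + 1, hpa.mono fun i hi y hy => hp hi hy⟩
  obtain ⟨M, hM⟩ := hbound
  refine intervalIntegral.tendsto_integral_filter_of_dominated_convergence (fun _ => M) ?_ ?_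
    intervalIntegrable_const ?_
  · filter_upwards [hm] with i hi
    rw [Set.uIoc_of_le hab]
    exact (hi.mono Set.Ioc_subset_Icc_self).aestronglyMeasurable measurableSet_Ioc
  · filter_upwards [hM] with i hi
    refine Eventually.of_forall fun x hx => hi x ?_
    rw [Set.uIoc_of_le hab] at hx
    exact Set.Ioc_subset_Icc_self hx
  · refine Eventually.of_forall fun x hx => ?_
    rw [Set.uIoc_of_le hab] at hx
    have hx' := Set.Ioc_subset_Icc_self hx
    exact (hF x hx').comp (tendsto_id.prodMk
      (tendsto_const_pure.mono_right (pure_le_nhdsWithin hx')))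

/-- Away from the integers there are no zeros of `1 - q ^ (s + r)` once `q = exp ℓ` is close enough
to `1`. -/
lemma exp_mul_add_ne_one {ℓ : ℝ} (hℓ : ℓ ≠ 0) {s : ℂ} {r : ℕ} (hs : s + r ≠ 0)
    (h : |ℓ * s.im| < 2 * Real.pi) : Complex.exp (ℓ * (s + r)) ≠ 1 := by
  intro he
  obtain ⟨n, hn⟩ := Complex.exp_eq_one_iff.1 he
  have him := congrArg Complex.im hn
  simp at him
  have hn0 : n = 0 := by
    by_contra hne
    have h1 : (1 : ℝ) ≤ |(n : ℝ)| := by exact_mod_cast Int.one_le_abs hne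
    rw [him, abs_mul, abs_of_pos Real.two_pi_pos] at h
    nlinarith [Real.two_pi_pos]
  rw [hn0] at hn
  simp only [Int.cast_zero, zero_mul, mul_eq_zero, Complex.ofReal_eq_zero] at hn
  exact hn.elim hℓ hs

/-- Joint continuity of `betaSeries` at `t = 0`, where only the constant term survives. -/
lemma tendsto_betaSeries_zero {α : Type*} {l : Filter α} {f g : α → ℂ} {s : ℂ}
    (hs : ∀ r : ℕ, s + r ≠ 0) (hf : Tendsto f l (𝓝 s)) (hg : Tendsto g l (𝓝 0)) :
    Tendsto (fun a => betaSeries (f a) (g a)) l (𝓝 s⁻¹) := by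
  obtain ⟨C₀, hC₀⟩ := (Metric.isBounded_range_of_tendsto _
    (tendsto_add_natCast_inv s)).exists_norm_le
  have hC0 : ∀ r : ℕ, ‖(s + r)⁻¹‖ ≤ C₀ := fun r => hC₀ _ ⟨r, rfl⟩
  have hC0' : 0 ≤ C₀ := (norm_nonneg _).trans (hC0 0)
  have hlim : ∀ r : ℕ, Tendsto (fun a => (f a + r)⁻¹) l (𝓝 (s + r)⁻¹) := fun r =>
    (hf.add_const _).inv₀ (hs r)
  have h1 : ∀ᶠ a in l, ∀ r : ℕ, ‖(f a + r)⁻¹‖ ≤ C₀ + 1 := by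
    refine eventually_forall_of_prod_atTop (fun r => ?_) ?_
    · exact (hlim r).norm.eventually_le_const (by linarith [hC0 r])
    · filter_upwards [(tendsto_norm_add_natCast hf).eventually_ge_atTop 1] with p hp
      rw [norm_inv]
      linarith [inv_le_one_of_one_le₀ hp]
  have h2 : ∀ᶠ a in l, ‖f a‖ ≤ ‖s‖ + 1 := hf.norm.eventually_le_const (lt_add_one _)
  have h3 : ∀ᶠ a in l, ‖g a‖ ≤ 1 / 2 := hg.norm.eventually_le_const (by norm_num)
  have hsum : s⁻¹ = ∑' r : ℕ, risingCoeff s r * (s + r)⁻¹ * 0 ^ r := by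
    rw [tsum_eq_single 0 (fun r hr => by simp [hr])]
    simp
  rw [hsum]
  refine tendsto_tsum_of_dominated_convergence (bound := fun r =>
    (C₀ + 1) * (‖risingCoeff ((‖s‖ + 1 : ℝ) : ℂ) r‖ * (1 / 2) ^ r))
    ((discSummable_risingCoeff _ _ (by norm_num) (by norm_num)).mul_left _) (fun r => ?_) ?_
  · have h4 : Continuous fun s => risingCoeff s r := by unfold risingCoeff; fun_prop
    exact (((h4.tendsto s).comp hf).mul (hlim r)).mul (hg.pow r)
  · filter_upwards [h1, h2, h3] with a ha1 ha2 ha3 r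
    rw [norm_mul, norm_mul, norm_pow]
    calc ‖risingCoeff (f a) r‖ * ‖(f a + r)⁻¹‖ * ‖g a‖ ^ r
        ≤ ‖risingCoeff ((‖s‖ + 1 : ℝ) : ℂ) r‖ * (C₀ + 1) * (1 / 2) ^ r := by
          gcongr
          · exact norm_risingCoeff_le ha2 r
          · exact ha1 r
      _ = _ := by ring

lemma one_sub_exp_mul (ℓ : ℝ) (y : ℂ) :
    1 - Complex.exp (ℓ * y) = (-ℓ : ℝ) * (y * expSlope (ℓ * y)) := by
  push_cast
  linear_combination mul_expSlope (ℓ * y)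

lemma one_sub_exp (ℓ : ℝ) : 1 - Complex.exp ℓ = (1 - Real.exp ℓ : ℝ) := by simp

lemma one_sub_exp_pos {ℓ : ℝ} (hℓ : ℓ < 0) : 0 < 1 - Real.exp ℓ :=
  sub_pos.2 (Real.exp_lt_one_iff.2 hℓ)

lemma one_sub_exp_ne_zero {ℓ : ℝ} (hℓ : ℓ < 0) : 1 - Complex.exp ℓ ≠ 0 := by
  rw [one_sub_exp]; exact_mod_cast (one_sub_exp_pos hℓ).ne'

lemma neg_ofReal_eq {ℓ : ℝ} (hℓ : ℓ < 0) : ((-ℓ : ℝ) : ℂ) = (1 - Real.exp ℓ : ℝ) / expSlope ℓ := by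
  have h := one_sub_exp_mul ℓ 1
  rw [mul_one, one_mul, one_sub_exp] at h
  have h0 : ((1 - Real.exp ℓ : ℝ) : ℂ) ≠ 0 := by exact_mod_cast (one_sub_exp_pos hℓ).ne'
  have hE : expSlope ℓ ≠ 0 := fun hE => h0 (by rw [h, hE, mul_zero])
  rw [h]
  field_simp

lemma expSlope_ofReal_ne_zero {ℓ : ℝ} (hℓ : ℓ < 0) : expSlope ℓ ≠ 0 := fun hE => by
  have h := neg_ofReal_eq hℓ
  rw [hE, div_zero] at h
  exact hℓ.ne (by simpa using h)

/-- Principal powers are multiplicative when one of the factors is positive. -/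
lemma ofReal_mul_cpow {c : ℝ} (hc : 0 < c) (y s : ℂ) : (c * y) ^ s = (c : ℂ) ^ s * y ^ s := by
  have hc0 : (c : ℂ) ≠ 0 := by exact_mod_cast hc.ne'
  rcases eq_or_ne y 0 with rfl | hy
  · rcases eq_or_ne s 0 with rfl | hs
    · simp
    · simp [Complex.zero_cpow hs]
  · rw [Complex.cpow_def_of_ne_zero (mul_ne_zero hc0 hy), Complex.cpow_def_of_ne_zero hc0,
      Complex.cpow_def_of_ne_zero hy, Complex.log_ofReal_mul hc hy, Complex.ofReal_log hc.le,
      add_mul, Complex.exp_add]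

/-- `(1 - q) ^ (-s) (1 - q ^ y) ^ s = [y]_q ^ s`. -/
lemma one_sub_exp_cpow {ℓ : ℝ} (hℓ : ℓ < 0) (s y : ℂ) :
    (1 - Complex.exp (ℓ * y)) ^ s =
      (1 - Complex.exp ℓ) ^ s * (y * expSlope (ℓ * y) / expSlope ℓ) ^ s := by
  rw [one_sub_exp_mul, neg_ofReal_eq hℓ, one_sub_exp]
  rw [← ofReal_mul_cpow (one_sub_exp_pos hℓ)]
  ring_nf

/-- The corrected zeta function divided by `q ^ s`, in terms of `ℓ = log q`. -/
noncomputable def correctedSeries (ℓ : ℝ) (s z : ℂ) : ℂ :=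
  (1 - Complex.exp ℓ) ^ s * balancedSeries ℓ s z

/-! ### Convergence to the Hurwitz series for `1 < re s` -/

/-- For `0 < re s`, expanding `(1 - q ^ (k + z)) ^ (-s)` and summing over `k` first gives the power
series `qSeries`. -/
lemma hasSum_qSeries {ℓ : ℝ} (hℓ : ℓ < 0) {s z : ℂ} (hs : 0 < s.re) (hz : 0 < z.re) :
    HasSum (fun k : ℕ => Complex.exp (ℓ * s * k) * (1 - Complex.exp (ℓ * (k + z))) ^ (-s))
      (qSeries ℓ s (Complex.exp (ℓ * z))) := by
  have ht := norm_exp_mul_lt_one hℓ hz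
  have hq := norm_exp_mul_lt_one hℓ hs
  set t := Complex.exp (ℓ * z)
  have hq1 : ‖Complex.exp ℓ‖ ≤ 1 := by
    rw [← Complex.ofReal_exp, Complex.norm_real, Real.norm_eq_abs, abs_of_pos (Real.exp_pos _)]
    exact Real.exp_le_one_iff.2 hℓ.le
  set f : ℕ × ℕ → ℂ := fun p => Complex.exp (ℓ * s) ^ p.1 *
    (risingCoeff s p.2 * (Complex.exp ℓ ^ p.1 * t) ^ p.2) with hf
  have hsum : Summable f := by
    refine Summable.of_norm_bounded (g := fun p : ℕ × ℕ =>
      ‖Complex.exp (ℓ * s)‖ ^ p.1 * (‖risingCoeff s p.2‖ * ‖t‖ ^ p.2))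
      ((summable_geometric_of_lt_one (norm_nonneg _) hq).mul_of_nonneg
        (discSummable_risingCoeff s _ (norm_nonneg t) ht) (fun k => by positivity)
        (fun k => by positivity)) fun p => ?_
    simp only [hf, norm_mul, norm_pow]
    gcongr
    exact mul_le_of_le_one_left (norm_nonneg _) (pow_le_one₀ (norm_nonneg _) hq1)
  have h1 : ∀ k : ℕ, HasSum (fun r => f (k, r))
      (Complex.exp (ℓ * s * k) * (1 - Complex.exp (ℓ * (k + z))) ^ (-s)) := by
    intro k
    have e1 : Complex.exp ℓ ^ k * t = Complex.exp (ℓ * (k + z)) := by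
      rw [← Complex.exp_nat_mul, ← Complex.exp_add]; ring_nf
    have e2 : Complex.exp (ℓ * s) ^ k = Complex.exp (ℓ * s * k) := by
      rw [← Complex.exp_nat_mul]; ring_nf
    have h2 := (hasSum_risingCoeff s (t := Complex.exp (ℓ * (k + z)))
      (norm_exp_mul_lt_one hℓ (by simpa using add_pos_of_nonneg_of_pos k.cast_nonneg hz))).mul_left
      (Complex.exp (ℓ * s * k))
    simpa only [hf, e1, e2] using h2
  have h3 : ∀ r : ℕ, HasSum (fun k => f (k, r))
      (risingCoeff s r * (1 - Complex.exp (ℓ * (s + r)))⁻¹ * t ^ r) := by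
    intro r
    have h4 : ‖Complex.exp (ℓ * (s + r))‖ < 1 :=
      norm_exp_mul_lt_one hℓ (by simpa using add_pos_of_pos_of_nonneg hs r.cast_nonneg)
    refine (((hasSum_geometric_of_norm_lt_one h4).mul_left (risingCoeff s r)).mul_right
      (t ^ r)).congr_fun fun k => ?_
    have e1 : Complex.exp (ℓ * (s + r)) ^ k =
        Complex.exp (ℓ * s) ^ k * (Complex.exp ℓ ^ k) ^ r := by
      rw [← pow_mul, mul_comm k r, pow_mul, ← mul_pow, ← Complex.exp_nat_mul _ r, ← Complex.exp_add]
      ring_nf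
    simp only [hf, e1, mul_pow]
    ring
  have h5 := hsum.hasSum.prod_fiberwise h1
  have h6 := ((Equiv.prodComm ℕ ℕ).hasSum_iff.2 hsum.hasSum).prod_fiberwise h3
  rw [qSeries, h6.tsum_eq]
  exact h5

/-- `|[y]_q| ≥ q ^ x * x` where `x = re y` and `q = exp ℓ`. The factor `q ^ x` is paid for by
`q ^ (s k)` in the terms of the series, which makes the terms bounded uniformly in `q`. -/
lemma le_norm_one_sub_exp_div {ℓ : ℝ} (hℓ : ℓ < 0) {y : ℂ} (hy : 0 ≤ y.re) :
    Real.exp (ℓ * y.re) * y.re ≤ ‖y * expSlope (ℓ * y) / expSlope ℓ‖ := by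
  have hpos := one_sub_exp_pos hℓ
  have h1 : y * expSlope (ℓ * y) / expSlope ℓ =
      (1 - Complex.exp (ℓ * y)) / (1 - Real.exp ℓ : ℝ) := by
    rw [one_sub_exp_mul, neg_ofReal_eq hℓ]
    have : ((1 - Real.exp ℓ : ℝ) : ℂ) ≠ 0 := by exact_mod_cast hpos.ne'
    have := expSlope_ofReal_ne_zero hℓ
    field_simp
  rw [h1, norm_div, Complex.norm_real, Real.norm_eq_abs, abs_of_pos hpos, le_div_iff₀ hpos]
  have h2 : 1 - Real.exp (ℓ * y.re) ≤ ‖1 - Complex.exp (ℓ * y)‖ := by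
    have := norm_sub_norm_le (1 : ℂ) (Complex.exp (ℓ * y))
    rwa [norm_one, Complex.norm_exp, Complex.re_ofReal_mul] at this
  refine le_trans ?_ h2
  have h3 : 1 - Real.exp ℓ ≤ -ℓ := by linarith [Real.add_one_le_exp ℓ]
  have h4 : Real.exp (ℓ * y.re) * Real.exp (-(ℓ * y.re)) = 1 := by rw [← Real.exp_add]; simp
  have h5 := Real.add_one_le_exp (-(ℓ * y.re))
  have h6 := Real.exp_pos (ℓ * y.re)
  calc Real.exp (ℓ * y.re) * y.re * (1 - Real.exp ℓ)
      ≤ Real.exp (ℓ * y.re) * y.re * (-ℓ) := by gcongr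
    _ ≤ 1 - Real.exp (ℓ * y.re) := by nlinarith

/-- The terms of `∑ q ^ (s k) / [k + z]_q ^ s`, with `q = exp ℓ`. The `q`-number is written through
`expSlope`, so that it is visibly continuous at `ℓ = 0`, where it equals `k + z`. -/
noncomputable def qTerm (k : ℕ) (ℓ : ℝ) (s z : ℂ) : ℂ :=
  Complex.exp (ℓ * s * k) * ((k + z) * expSlope (ℓ * (k + z)) / expSlope ℓ) ^ (-s)

lemma hasSum_qTerm {ℓ : ℝ} (hℓ : ℓ < 0) {s z : ℂ} (hs : 0 < s.re) (hz : 0 < z.re) :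
    HasSum (fun k => qTerm k ℓ s z)
      ((1 - Complex.exp ℓ) ^ s * qSeries ℓ s (Complex.exp (ℓ * z))) := by
  refine ((hasSum_qSeries hℓ hs hz).mul_left ((1 - Complex.exp ℓ) ^ s)).congr_fun fun k => ?_
  have h0 := one_sub_exp_ne_zero hℓ
  have h1 : (1 - Complex.exp ℓ) ^ s * (1 - Complex.exp ℓ) ^ (-s) = 1 := by
    rw [← Complex.cpow_add _ _ h0]; simp
  rw [one_sub_exp_cpow hℓ, qTerm]
  linear_combination -(Complex.exp (ℓ * s * k) *
    ((k + z) * expSlope (ℓ * (k + z)) / expSlope ℓ) ^ (-s)) * h1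

lemma correctedSeries_eq_tsum {ℓ : ℝ} (hℓ : ℓ < 0) {s z : ℂ} (hs : 0 < s.re) (hz : 0 < z.re) :
    correctedSeries ℓ s z = (∑' k, qTerm k ℓ s z) + (1 - Complex.exp ℓ) ^ s *
      (Complex.exp (-(ℓ * s * z)) * (Real.pi / (ℓ * Complex.sin (Real.pi * s)))) := by
  rw [correctedSeries, balancedSeries, mul_add, (hasSum_qTerm hℓ hs hz).tsum_eq]

lemma norm_cpow_neg_le {v s : ℂ} {a : ℝ} (ha : 0 < a) (hv : a ≤ ‖v‖) (hs : 0 ≤ s.re) :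
    ‖v ^ (-s)‖ ≤ a ^ (-s.re) * Real.exp (Real.pi * |s.im|) := by
  have hv0 : v ≠ 0 := norm_pos_iff.1 (ha.trans_le hv)
  have h1 : ‖v‖ ^ (-s.re) ≤ a ^ (-s.re) := Real.rpow_le_rpow_of_nonpos ha hv (by linarith)
  have h2 : -(Real.pi * |s.im|) ≤ v.arg * (-s).im := by
    have h3 : |v.arg * (-s).im| ≤ Real.pi * |s.im| := by
      rw [abs_mul, Complex.neg_im, abs_neg]
      gcongr
      exact Complex.abs_arg_le_pi v
    exact (abs_le.1 h3).1
  rw [Complex.norm_cpow_of_ne_zero hv0, div_eq_mul_inv, ← Real.exp_neg]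
  gcongr
  · exact h1
  · linarith

lemma norm_qTerm_le {ℓ : ℝ} (hℓ : ℓ < 0) (k : ℕ) {s z : ℂ} (hs : 0 < s.re) (hz : 0 < z.re) :
    ‖qTerm k ℓ s z‖ ≤
      Real.exp (-(ℓ * (s.re * z.re)) + Real.pi * |s.im|) * (k + z.re) ^ (-s.re) := by
  have hre : ((k : ℂ) + z).re = k + z.re := by simp
  have hpos : 0 < (k : ℝ) + z.re := add_pos_of_nonneg_of_pos k.cast_nonneg hz
  have hlow := le_norm_one_sub_exp_div hℓ (y := k + z) (by rw [hre]; exact hpos.le)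
  rw [hre] at hlow
  set v := ((k : ℂ) + z) * expSlope (ℓ * (k + z)) / expSlope ℓ with hv
  have hlow0 : 0 < Real.exp (ℓ * (k + z.re)) * (k + z.re) := mul_pos (Real.exp_pos _) hpos
  have h4 : ‖Complex.exp (ℓ * s * k)‖ = Real.exp (ℓ * s.re * k) := by
    rw [Complex.norm_exp]; simp
  rw [qTerm, ← hv, norm_mul, h4]
  calc Real.exp (ℓ * s.re * k) * ‖v ^ (-s)‖
      ≤ Real.exp (ℓ * s.re * k) * ((Real.exp (ℓ * (k + z.re)) * (k + z.re)) ^ (-s.re) *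
          Real.exp (Real.pi * |s.im|)) := by
        gcongr
        exact norm_cpow_neg_le hlow0 hlow hs.le
    _ = _ := by
        rw [Real.mul_rpow (Real.exp_pos _).le hpos.le, ← Real.exp_mul,
          show Real.exp (-(ℓ * (s.re * z.re)) + Real.pi * |s.im|) = Real.exp (ℓ * s.re * k) *
            Real.exp (ℓ * (k + z.re) * -s.re) * Real.exp (Real.pi * |s.im|) by
              rw [← Real.exp_add, ← Real.exp_add]; ring_nf]
        ring

/-- A summable majorant, uniform near a point `(s₀, z₀)` and in `-1 ≤ ℓ`, of the bounds for both
the `q`-series and (at `ℓ = 0`) the Hurwitz series. -/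
lemma exists_summable_bound {s₀ z₀ : ℂ} (hs : 1 < s₀.re) (hz : 0 < z₀.re) :
    ∃ u : ℕ → ℝ, Summable u ∧ ∀ᶠ p in 𝓝 (s₀, z₀), ∀ k : ℕ, ∀ ℓ : ℝ, -1 ≤ ℓ →
      1 < p.1.re ∧ 0 < p.2.re ∧
      Real.exp (-(ℓ * (p.1.re * p.2.re)) + Real.pi * |p.1.im|) * (k + p.2.re) ^ (-p.1.re) ≤
        u k := by
  set σ := (1 + s₀.re) / 2 with hσ
  set τ := s₀.re + 1
  set x := min (z₀.re / 2) 1 with hx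
  have hx0 : 0 < x := lt_min (by linarith) one_pos
  set K := Real.exp (τ * (z₀.re + 1) + Real.pi * (|s₀.im| + 1)) * x ^ (-τ)
  refine ⟨fun k => K * ((k + 1 : ℕ) : ℝ) ^ (-σ), ?_, ?_⟩
  · refine Summable.mul_left _ ((summable_nat_add_iff (f := fun n : ℕ => (n : ℝ) ^ (-σ)) 1).2 ?_)
    exact Real.summable_nat_rpow.2 (by linarith)
  have c1 : Continuous fun p : ℂ × ℂ => p.1.re := by fun_prop
  have c2 : Continuous fun p : ℂ × ℂ => p.2.re := by fun_prop
  have c3 : Continuous fun p : ℂ × ℂ => |p.1.im| := by fun_prop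
  filter_upwards [(c1.tendsto (s₀, z₀)).eventually_const_le (show σ < s₀.re by linarith),
    (c1.tendsto (s₀, z₀)).eventually_le_const (show s₀.re < τ from lt_add_one _),
    (c2.tendsto (s₀, z₀)).eventually_const_le (show z₀.re / 2 < z₀.re by linarith),
    (c2.tendsto (s₀, z₀)).eventually_le_const (show z₀.re < z₀.re + 1 from lt_add_one _),
    (c3.tendsto (s₀, z₀)).eventually_le_const (show |s₀.im| < |s₀.im| + 1 from lt_add_one _)]
    with p h1 h2 h3 h4 h5 k ℓ hℓ
  have hp1 : 1 < p.1.re := by linarith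
  have hp2 : 0 < p.2.re := by linarith
  refine ⟨hp1, hp2, ?_⟩
  have hk : (0 : ℝ) ≤ k := k.cast_nonneg
  have e1 : -(ℓ * (p.1.re * p.2.re)) ≤ τ * (z₀.re + 1) := by
    have : p.1.re * p.2.re ≤ τ * (z₀.re + 1) := by gcongr
    have : 0 ≤ p.1.re * p.2.re := by positivity
    nlinarith
  have e2 : x * (k + 1) ≤ k + p.2.re := by
    have : x ≤ 1 := min_le_right _ _
    have : x ≤ p.2.re := (min_le_left _ _).trans h3
    nlinarith
  calc Real.exp (-(ℓ * (p.1.re * p.2.re)) + Real.pi * |p.1.im|) * (k + p.2.re) ^ (-p.1.re)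
      ≤ Real.exp (τ * (z₀.re + 1) + Real.pi * (|s₀.im| + 1)) * (x * (k + 1)) ^ (-p.1.re) := by
        refine mul_le_mul ?_ ?_ (by positivity) (by positivity)
        · gcongr
        · exact Real.rpow_le_rpow_of_nonpos (by positivity) e2 (by linarith)
    _ = Real.exp (τ * (z₀.re + 1) + Real.pi * (|s₀.im| + 1)) *
          (x ^ (-p.1.re) * ((k + 1 : ℕ) : ℝ) ^ (-p.1.re)) := by
        rw [Real.mul_rpow hx0.le (by positivity)]; push_cast; rfl
    _ ≤ Real.exp (τ * (z₀.re + 1) + Real.pi * (|s₀.im| + 1)) *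
          (x ^ (-τ) * ((k + 1 : ℕ) : ℝ) ^ (-σ)) := by
        gcongr ?_ * (?_ * ?_)
        · exact Real.rpow_le_rpow_of_exponent_ge hx0 (min_le_right _ _) (by linarith)
        · exact Real.rpow_le_rpow_of_exponent_le (by push_cast; linarith) (by linarith)
    _ = _ := by ring

section
variable {s₀ z₀ : ℂ}

/-! Limits are taken at `ℓ → 0⁻` jointly with `(s, z) → (s₀, z₀)`, that is, along the filter
`𝓝[<] 0 ×ˢ 𝓝 (s₀, z₀)` on `ℝ × ℂ × ℂ`. -/

lemma tendsto_ell : Tendsto (fun p : ℝ × ℂ × ℂ => (p.1 : ℂ)) (𝓝[<] 0 ×ˢ 𝓝 (s₀, z₀)) (𝓝 0) :=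
  (Complex.continuous_ofReal.tendsto' 0 0 (by simp)).comp
    (tendsto_fst.mono_right nhdsWithin_le_nhds)

lemma tendsto_s : Tendsto (fun p : ℝ × ℂ × ℂ => p.2.1) (𝓝[<] 0 ×ˢ 𝓝 (s₀, z₀)) (𝓝 s₀) :=
  (continuous_fst.tendsto (s₀, z₀)).comp tendsto_snd

lemma tendsto_z : Tendsto (fun p : ℝ × ℂ × ℂ => p.2.2) (𝓝[<] 0 ×ˢ 𝓝 (s₀, z₀)) (𝓝 z₀) :=
  (continuous_snd.tendsto (s₀, z₀)).comp tendsto_snd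

lemma eventually_ell : ∀ᶠ p : ℝ × ℂ × ℂ in 𝓝[<] 0 ×ˢ 𝓝 (s₀, z₀), -1 < p.1 ∧ p.1 < 0 := by
  have h : ∀ᶠ ℓ : ℝ in 𝓝[<] 0, -1 < ℓ ∧ ℓ < 0 := by
    filter_upwards [Ioo_mem_nhdsLT (show (-1 : ℝ) < 0 by norm_num)] with ℓ hℓ using hℓ
  exact tendsto_fst.eventually h

end

lemma tendsto_expSlope {α : Type*} {l : Filter α} {f : α → ℂ} (hf : Tendsto f l (𝓝 0)) :
    Tendsto (fun a => expSlope (f a)) l (𝓝 1) := by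
  have h := (continuous_expSlope.tendsto 0).comp hf
  rwa [expSlope_zero] at h

/-- For `1 < re s` the corrected series converges to the Hurwitz series as `q → 1`. -/
lemma tendsto_correctedSeries_of_one_lt_re {s₀ z₀ : ℂ} (hs : s₀ ∈ nonintegers) (h1 : 1 < s₀.re)
    (hz : 0 < z₀.re) :
    Tendsto (fun p : ℝ × ℂ × ℂ => correctedSeries p.1 p.2.1 p.2.2) (𝓝[<] 0 ×ˢ 𝓝 (s₀, z₀))
      (𝓝 (∑' k, hurwitzTerm z₀ k s₀)) := by
  obtain ⟨u, hu, hbound⟩ := exists_summable_bound h1 hz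
  have hb := eventually_ell.and (tendsto_snd.eventually hbound)
  have t1 : Tendsto (fun p : ℝ × ℂ × ℂ => ∑' k, qTerm k p.1 p.2.1 p.2.2) (𝓝[<] 0 ×ˢ 𝓝 (s₀, z₀))
      (𝓝 (∑' k, hurwitzTerm z₀ k s₀)) := by
    refine tendsto_tsum_of_dominated_convergence hu (fun k => ?_) ?_
    · have hy := (tendsto_z (s₀ := s₀) (z₀ := z₀)).const_add (k : ℂ)
      have hE := tendsto_expSlope (by simpa using tendsto_ell.mul hy)
      have hE1 := tendsto_expSlope (tendsto_ell (s₀ := s₀) (z₀ := z₀))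
      have hv := (hy.mul hE).div hE1 one_ne_zero
      have hexp := ((tendsto_ell.mul (tendsto_s (s₀ := s₀) (z₀ := z₀))).mul_const (k : ℂ)).cexp
      have hpow := hv.cpow (tendsto_s (s₀ := s₀) (z₀ := z₀)).neg
        (by left; simpa using add_pos_of_nonneg_of_pos k.cast_nonneg hz)
      simpa [qTerm, hurwitzTerm, Complex.cpow_neg] using hexp.mul hpow
    · filter_upwards [hb] with p hp k
      obtain ⟨⟨h2, h3⟩, h4⟩ := hp
      obtain ⟨h5, h6, h7⟩ := h4 k p.1 h2.le
      exact (norm_qTerm_le h3 k (by linarith) h6).trans h7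
  -- The correction carries `(1 - q) ^ s / log q`, of size `(1 - q) ^ (s - 1)`, and vanishes.
  have t2 : Tendsto (fun p : ℝ × ℂ × ℂ => -((1 - Complex.exp p.1) ^ (p.2.1 - 1) * expSlope p.1) *
      (Complex.exp (-(p.1 * p.2.1 * p.2.2)) * (Real.pi / Complex.sin (Real.pi * p.2.1))))
      (𝓝[<] 0 ×ˢ 𝓝 (s₀, z₀)) (𝓝 0) := by
    have h0 : Tendsto (fun p : ℝ × ℂ × ℂ => 1 - Complex.exp p.1) (𝓝[<] 0 ×ˢ 𝓝 (s₀, z₀))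
        (𝓝 0) := by
      simpa using (tendsto_ell (s₀ := s₀) (z₀ := z₀)).cexp.const_sub 1
    have hs1 : 0 < (s₀ - 1).re := by simpa using h1
    have hpow : Tendsto (fun p : ℝ × ℂ × ℂ => (1 - Complex.exp p.1) ^ (p.2.1 - 1))
        (𝓝[<] 0 ×ˢ 𝓝 (s₀, z₀)) (𝓝 0) := by
      have h := (Complex.continuousAt_cpow_zero_of_re_pos hs1).tendsto.comp
        (h0.prodMk_nhds ((tendsto_s (s₀ := s₀) (z₀ := z₀)).sub_const 1))
      rw [Complex.zero_cpow (fun h' : s₀ - 1 = 0 => by simp [h'] at hs1)] at h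
      exact h
    have hE1 := tendsto_expSlope (tendsto_ell (s₀ := s₀) (z₀ := z₀))
    have hexp := ((tendsto_ell.mul (tendsto_s (s₀ := s₀) (z₀ := z₀))).mul tendsto_z).neg.cexp
    have hsin := ((Complex.continuous_sin.tendsto _).comp
      ((tendsto_s (s₀ := s₀) (z₀ := z₀)).const_mul (Real.pi : ℂ)))
    simpa using (hpow.mul hE1).neg.mul
      (hexp.mul (tendsto_const_nhds.div hsin (sin_pi_mul_ne_zero_of_mem hs)))
  have t3 := t1.add t2
  rw [add_zero] at t3
  refine t3.congr' ?_
  filter_upwards [hb] with p hp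
  obtain ⟨⟨h2, h3⟩, h4⟩ := hp
  obtain ⟨h5, h6, -⟩ := h4 0 p.1 h2.le
  rw [correctedSeries_eq_tsum h3 (by linarith) h6]
  congr 1
  have h0 := one_sub_exp_ne_zero h3
  have hℓ0 : (p.1 : ℂ) ≠ 0 := by exact_mod_cast h3.ne
  have h7 := mul_expSlope p.1
  rw [Complex.cpow_sub _ _ h0, Complex.cpow_one]
  have h8 : expSlope p.1 = -(1 - Complex.exp p.1) / p.1 := by
    rw [eq_div_iff hℓ0]; linear_combination h7
  rw [h8]
  field_simp

/-! ### The recursion in the limit `q → 1` -/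

/-- The recursion for `correctedSeries` with all factors written so that they converge as
`ℓ → 0`. The incomplete beta function at `q ^ z` has been reflected to `1 - q ^ z`. -/
lemma correctedSeries_recursion {ℓ : ℝ} (hℓ : ℓ < 0) {s z : ℂ} (hs : s ∈ nonintegers)
    (hz : 0 < z.re) (hsim : |ℓ * s.im| < 2 * Real.pi) (hzim : |ℓ * z.im| < Real.pi)
    (hzt : ‖1 - Complex.exp (ℓ * z)‖ < 1) (hE : expSlope (ℓ * s) ≠ 0) :
    correctedSeries ℓ s z = (expSlope (ℓ * s))⁻¹ * (-(Complex.exp (-(ℓ * s * z)) *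
        ((z * expSlope (ℓ * z) / expSlope ℓ) ^ (1 - s) * expSlope ℓ *
          betaSeries (1 - s) (1 - Complex.exp (ℓ * z)))) +
      s * ∫ x in (0 : ℝ)..1, (1 - x) * Complex.exp (ℓ * s * x) * expSlope (ℓ * s * (1 - x)) *
        ((expSlope ℓ)⁻¹ * Complex.exp (ℓ * (z + x)) * correctedSeries ℓ (s + 1) (z + x))) := by
  have hrec := balancedSeries_recursion hℓ hs
    (fun r => exp_mul_add_ne_one hℓ.ne (add_natCast_ne_zero hs r) hsim) hz
  have hcp : Complex.exp (ℓ * s * z) = Complex.exp (ℓ * z) ^ s := by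
    have h1 := abs_lt.1 hzim
    rw [Complex.cpow_def_of_ne_zero (Complex.exp_ne_zero _), Complex.log_exp]
    · ring_nf
    · simpa using h1.1
    · simpa using h1.2.le
  have hrefl := betaSeries_reflection hs (norm_exp_mul_lt_one hℓ hz) hzt
  rw [hcp, ← hrefl, add_sub_cancel_left, one_sub_exp_cpow hℓ] at hrec
  have h0 := one_sub_exp_ne_zero hℓ
  have hℓ0 : (ℓ : ℂ) ≠ 0 := by exact_mod_cast hℓ.ne
  have hE0 := expSlope_ofReal_ne_zero hℓ
  have h7 : 1 - Complex.exp ℓ = -ℓ * expSlope ℓ := by linear_combination mul_expSlope ℓ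
  have hp1 : (1 - Complex.exp ℓ) ^ s * (1 - Complex.exp ℓ) ^ (1 - s) = 1 - Complex.exp ℓ := by
    rw [← Complex.cpow_add _ _ h0]; simp
  have hp2 : (1 - Complex.exp ℓ) ^ (s + 1) = (1 - Complex.exp ℓ) ^ s * (1 - Complex.exp ℓ) := by
    rw [Complex.cpow_add _ _ h0, Complex.cpow_one]
  have hint : (∫ x in (0 : ℝ)..1, (1 - x) * Complex.exp (ℓ * s * x) *
      expSlope (ℓ * s * (1 - x)) * ((expSlope ℓ)⁻¹ * Complex.exp (ℓ * (z + x)) *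
        correctedSeries ℓ (s + 1) (z + x))) = -(1 - Complex.exp ℓ) ^ s *
      ∫ x in (0 : ℝ)..1, (1 - x) * Complex.exp (ℓ * s * x) * expSlope (ℓ * s * (1 - x)) *
        (ℓ * Complex.exp (ℓ * (z + x)) * balancedSeries ℓ (s + 1) (z + x)) := by
    rw [← intervalIntegral.integral_const_mul]
    refine intervalIntegral.integral_congr fun x _ => ?_
    simp only [correctedSeries]
    rw [hp2, h7]
    field_simp
  rw [hint, eq_inv_mul_iff_mul_eq₀ hE, correctedSeries, mul_left_comm, hrec]
  set B := betaSeries (1 - s) (1 - Complex.exp (ℓ * z))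
  set V := (z * expSlope (ℓ * z) / expSlope ℓ) ^ (1 - s)
  have h8 : (1 - Complex.exp ℓ) ^ s * ((1 - Complex.exp ℓ) ^ (1 - s) * V * B / ℓ) =
      -(V * expSlope ℓ * B) := by
    rw [show (1 - Complex.exp ℓ) ^ s * ((1 - Complex.exp ℓ) ^ (1 - s) * V * B / ℓ) =
      ((1 - Complex.exp ℓ) ^ s * (1 - Complex.exp ℓ) ^ (1 - s)) * V * B / ℓ by ring, hp1, h7]
    field_simp
  linear_combination Complex.exp (-(ℓ * s * z)) * h8

/-- Convergence of the integral in the recursion, given convergence at `s₀ + 1`. -/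
lemma tendsto_integral_correctedSeries {s₀ z₀ : ℂ} (hz : 0 < z₀.re)
    {H : ℂ → ℂ} (hH : ∀ z : ℂ, 0 < z.re →
      Tendsto (fun p : ℝ × ℂ × ℂ => correctedSeries p.1 p.2.1 p.2.2)
        (𝓝[<] 0 ×ˢ 𝓝 (s₀ + 1, z)) (𝓝 (H z))) :
    Tendsto (fun p : ℝ × ℂ × ℂ => ∫ x in (0 : ℝ)..1, (1 - x) *
      Complex.exp (p.1 * p.2.1 * x) * expSlope (p.1 * p.2.1 * (1 - x)) * ((expSlope p.1)⁻¹ *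
        Complex.exp (p.1 * (p.2.2 + x)) * correctedSeries p.1 (p.2.1 + 1) (p.2.2 + x)))
      (𝓝[<] 0 ×ˢ 𝓝 (s₀, z₀)) (𝓝 (∫ x in (0 : ℝ)..1, (1 - x) * H (z₀ + x))) := by
  have tl := tendsto_ell (s₀ := s₀) (z₀ := z₀)
  have ts := tendsto_s (s₀ := s₀) (z₀ := z₀)
  have tz := tendsto_z (s₀ := s₀) (z₀ := z₀)
  have hzre : ∀ᶠ p : ℝ × ℂ × ℂ in 𝓝[<] 0 ×ˢ 𝓝 (s₀, z₀), 0 < p.2.2.re :=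
    ((Complex.continuous_re.tendsto z₀).comp tz).eventually_const_lt hz
  refine tendsto_intervalIntegral_of_tendsto_prod (zero_le_one' ℝ) (fun x hx => ?_) ?_
  · have hx0 : 0 < (z₀ + x).re := by simpa using add_pos_of_pos_of_nonneg hz hx.1
    have l0 : Tendsto (fun p : (ℝ × ℂ × ℂ) × ℝ => p.1.1)
      ((𝓝[<] 0 ×ˢ 𝓝 (s₀, z₀)) ×ˢ 𝓝[Set.Icc 0 1] x) (𝓝[<] 0) :=
      tendsto_fst.comp tendsto_fst
    have l1 : Tendsto (fun p : (ℝ × ℂ × ℂ) × ℝ => ((p.1.1 : ℂ)))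
      ((𝓝[<] 0 ×ˢ 𝓝 (s₀, z₀)) ×ˢ 𝓝[Set.Icc 0 1] x) (𝓝 0) := tl.comp tendsto_fst
    have l2 : Tendsto (fun p : (ℝ × ℂ × ℂ) × ℝ => p.1.2.1)
      ((𝓝[<] 0 ×ˢ 𝓝 (s₀, z₀)) ×ˢ 𝓝[Set.Icc 0 1] x) (𝓝 s₀) := ts.comp tendsto_fst
    have l3 : Tendsto (fun p : (ℝ × ℂ × ℂ) × ℝ => p.1.2.2)
      ((𝓝[<] 0 ×ˢ 𝓝 (s₀, z₀)) ×ˢ 𝓝[Set.Icc 0 1] x) (𝓝 z₀) := tz.comp tendsto_fst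
    have l4 : Tendsto (fun p : (ℝ × ℂ × ℂ) × ℝ => ((p.2 : ℝ) : ℂ))
      ((𝓝[<] 0 ×ˢ 𝓝 (s₀, z₀)) ×ˢ 𝓝[Set.Icc 0 1] x) (𝓝 x) :=
      (Complex.continuous_ofReal.tendsto x).comp (tendsto_snd.mono_right nhdsWithin_le_nhds)
    have l5 : Tendsto (fun p : (ℝ × ℂ × ℂ) × ℝ =>
        correctedSeries p.1.1 (p.1.2.1 + 1) (p.1.2.2 + p.2))
        ((𝓝[<] 0 ×ˢ 𝓝 (s₀, z₀)) ×ˢ 𝓝[Set.Icc 0 1] x) (𝓝 (H (z₀ + x))) := by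
      have m : Tendsto (fun p : (ℝ × ℂ × ℂ) × ℝ =>
          ((p.1.1, p.1.2.1 + 1, p.1.2.2 + p.2) : ℝ × ℂ × ℂ))
          ((𝓝[<] 0 ×ˢ 𝓝 (s₀, z₀)) ×ˢ 𝓝[Set.Icc 0 1] x)
          (𝓝[<] 0 ×ˢ 𝓝 (s₀ + 1, z₀ + (x : ℂ))) :=
        l0.prodMk ((l2.add_const 1).prodMk_nhds (l3.add l4))
      have h := (hH (z₀ + x) hx0).comp m
      exact h
    have e1 := ((l1.mul l2).mul l4).cexp
    have e2 := tendsto_expSlope (by simpa using (l1.mul l2).mul (l4.const_sub 1))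
    have e3 := (tendsto_expSlope l1).inv₀ one_ne_zero
    have e4 := (l1.mul (l3.add l4)).cexp
    simpa using (((l4.const_sub 1).mul e1).mul e2).mul ((e3.mul e4).mul l5)
  · filter_upwards [eventually_ell, hzre] with p hp hpz
    have c1 : ContinuousOn (fun x : ℝ => correctedSeries p.1 (p.2.1 + 1) (p.2.2 + x))
        (Set.Icc 0 1) := by
      intro x hx
      have hx0 : 0 < (p.2.2 + x).re := by simpa using add_pos_of_pos_of_nonneg hpz hx.1
      have h1 := (hasDerivAt_balancedSeries hp.2 (p.2.1 + 1) hx0).continuousAt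
      have h2 : ContinuousAt (fun x : ℝ => p.2.2 + (x : ℂ)) x := by fun_prop
      exact (continuousAt_const.mul (ContinuousAt.comp (f := fun x : ℝ => p.2.2 + (x : ℂ))
        h1 h2)).continuousWithinAt
    have c2 : Continuous fun x : ℝ => expSlope (p.1 * p.2.1 * (1 - x)) :=
      continuous_expSlope.comp (by fun_prop)
    have c3 : Continuous fun x : ℝ => (1 - x) * Complex.exp (p.1 * p.2.1 * x) *
      expSlope (p.1 * p.2.1 * (1 - x)) := by fun_prop
    have c4 : Continuous fun x : ℝ => (expSlope p.1)⁻¹ * Complex.exp (p.1 * (p.2.2 + x)) := by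
      fun_prop
    exact c3.continuousOn.mul (c4.continuousOn.mul c1)

/-- Convergence of the explicit term of the recursion. -/
lemma tendsto_explicit_term {s₀ z₀ : ℂ} (hs : s₀ ∈ nonintegers) (hz : 0 < z₀.re) :
    Tendsto (fun p : ℝ × ℂ × ℂ => Complex.exp (-(p.1 * p.2.1 * p.2.2)) *
        ((p.2.2 * expSlope (p.1 * p.2.2) / expSlope p.1) ^ (1 - p.2.1) * expSlope p.1 *
          betaSeries (1 - p.2.1) (1 - Complex.exp (p.1 * p.2.2)))) (𝓝[<] 0 ×ˢ 𝓝 (s₀, z₀))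
      (𝓝 (z₀ ^ (1 - s₀) * (1 - s₀)⁻¹)) := by
  have tl := tendsto_ell (s₀ := s₀) (z₀ := z₀)
  have ts := tendsto_s (s₀ := s₀) (z₀ := z₀)
  have tz := tendsto_z (s₀ := s₀) (z₀ := z₀)
  have tE := tendsto_expSlope tl
  have tEz : Tendsto (fun p : ℝ × ℂ × ℂ => expSlope (p.1 * p.2.2)) (𝓝[<] 0 ×ˢ 𝓝 (s₀, z₀)) (𝓝 1) :=
    tendsto_expSlope (by simpa using tl.mul tz)
  have tt : Tendsto (fun p : ℝ × ℂ × ℂ => 1 - Complex.exp (p.1 * p.2.2))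
      (𝓝[<] 0 ×ˢ 𝓝 (s₀, z₀)) (𝓝 0) := by
    simpa using (tl.mul tz).cexp.const_sub 1
  have e1 := ((tl.mul ts).mul tz).neg.cexp
  have e2 := ((tz.mul tEz).div tE one_ne_zero).cpow (ts.const_sub 1) (by left; simpa using hz)
  have e3 := tendsto_betaSeries_zero (add_natCast_ne_zero (one_sub_mem_nonintegers hs))
    (ts.const_sub 1) tt
  simpa using e1.mul ((e2.mul tE).mul e3)

/-- Convergence of the corrected series at `s₀ + 1` for all `z` implies its convergence at `s₀`. -/
lemma tendsto_correctedSeries_of_add_one {s₀ z₀ : ℂ} (hs : s₀ ∈ nonintegers) (hz : 0 < z₀.re)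
    {H : ℂ → ℂ} (hH : ∀ z : ℂ, 0 < z.re →
      Tendsto (fun p : ℝ × ℂ × ℂ => correctedSeries p.1 p.2.1 p.2.2)
        (𝓝[<] 0 ×ˢ 𝓝 (s₀ + 1, z)) (𝓝 (H z))) :
    Tendsto (fun p : ℝ × ℂ × ℂ => correctedSeries p.1 p.2.1 p.2.2) (𝓝[<] 0 ×ˢ 𝓝 (s₀, z₀))
      (𝓝 (z₀ ^ (1 - s₀) / (s₀ - 1) + s₀ * ∫ x in (0 : ℝ)..1, (1 - x) * H (z₀ + x))) := by
  have tl := tendsto_ell (s₀ := s₀) (z₀ := z₀)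
  have ts := tendsto_s (s₀ := s₀) (z₀ := z₀)
  have tz := tendsto_z (s₀ := s₀) (z₀ := z₀)
  have tEs : Tendsto (fun p : ℝ × ℂ × ℂ => expSlope (p.1 * p.2.1)) (𝓝[<] 0 ×ˢ 𝓝 (s₀, z₀)) (𝓝 1) :=
    tendsto_expSlope (by simpa using tl.mul ts)
  have tt : Tendsto (fun p : ℝ × ℂ × ℂ => 1 - Complex.exp (p.1 * p.2.2))
      (𝓝[<] 0 ×ˢ 𝓝 (s₀, z₀)) (𝓝 0) := by
    simpa using (tl.mul tz).cexp.const_sub 1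
  have hzre : ∀ᶠ p : ℝ × ℂ × ℂ in 𝓝[<] 0 ×ˢ 𝓝 (s₀, z₀), 0 < p.2.2.re :=
    ((Complex.continuous_re.tendsto z₀).comp tz).eventually_const_lt hz
  have hsn : ∀ᶠ p : ℝ × ℂ × ℂ in 𝓝[<] 0 ×ˢ 𝓝 (s₀, z₀), p.2.1 ∈ nonintegers :=
    ts.eventually (isOpen_nonintegers.mem_nhds hs)
  have im_small : ∀ {f : ℝ × ℂ × ℂ → ℂ} {w : ℂ}, Tendsto f (𝓝[<] 0 ×ˢ 𝓝 (s₀, z₀)) (𝓝 w) →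
      ∀ᶠ p in 𝓝[<] 0 ×ˢ 𝓝 (s₀, z₀), |p.1 * (f p).im| < Real.pi := by
    intro f w hf
    have h1 : Tendsto (fun p => |(p.1 * f p : ℂ).im|) (𝓝[<] 0 ×ˢ 𝓝 (s₀, z₀)) (𝓝 0) := by
      simpa using ((Complex.continuous_im.tendsto _).comp (tl.mul hf)).abs
    filter_upwards [h1.eventually_lt_const Real.pi_pos] with p hp
    simpa using hp
  have hlim := (tEs.inv₀ one_ne_zero).mul ((tendsto_explicit_term hs hz).neg.add
    (ts.mul (tendsto_integral_correctedSeries hz hH)))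
  have heq : (1 : ℂ)⁻¹ * (-(z₀ ^ (1 - s₀) * (1 - s₀)⁻¹) + s₀ * ∫ x in (0 : ℝ)..1,
      (1 - x) * H (z₀ + x)) =
      z₀ ^ (1 - s₀) / (s₀ - 1) + s₀ * ∫ x in (0 : ℝ)..1, (1 - x) * H (z₀ + x) := by
    rw [show s₀ - 1 = -(1 - s₀) by ring, div_neg]
    ring
  rw [heq] at hlim
  refine hlim.congr' ?_
  filter_upwards [eventually_ell, hsn, hzre, im_small ts, im_small tz,
    tt.norm.eventually_lt_const (by simp : ‖(0 : ℂ)‖ < 1), tEs.eventually_ne one_ne_zero]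
    with p h1 h2 h3 h4 h5 h6 h7
  exact (correctedSeries_recursion h1.2 h2 h3 (h4.trans (by linarith [Real.pi_pos])) h5 h6 h7).symm

/-! ### Continuation of the Hurwitz zeta function -/

/-- Holomorphic dependence on a parameter of an integral over `[0, 1]`. -/
lemma differentiableAt_intervalIntegral {f : ℂ → ℝ → ℂ} {U : Set ℂ} (hU : IsOpen U) {s₀ : ℂ}
    (hs₀ : s₀ ∈ U) (hd : ∀ s ∈ U, ∀ x ∈ Set.Icc (0 : ℝ) 1, DifferentiableAt ℂ (fun s => f s x) s)
    (hc : ContinuousOn (fun p : ℂ × ℝ => f p.1 p.2) (U ×ˢ Set.Icc 0 1)) :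
    DifferentiableAt ℂ (fun s => ∫ x in (0 : ℝ)..1, f s x) s₀ := by
  obtain ⟨ε, hε, hball⟩ := Metric.isOpen_iff.1 hU s₀ hs₀
  set ρ := ε / 3 with hρ
  have hρ0 : 0 < ρ := by positivity
  have hK : Metric.closedBall s₀ (2 * ρ) ⊆ U := fun s hs => hball <| by
    rw [Metric.mem_closedBall] at hs
    rw [Metric.mem_ball]
    linarith
  obtain ⟨M, hM⟩ := (((isCompact_closedBall s₀ (2 * ρ)).prod
    (isCompact_Icc (a := (0 : ℝ)) (b := 1)))).exists_bound_of_continuousOn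
      (hc.mono (Set.prod_mono hK le_rfl))
  have hIoc : Set.uIoc (0 : ℝ) 1 ⊆ Set.Icc 0 1 := by
    rw [Set.uIoc_of_le zero_le_one]; exact Set.Ioc_subset_Icc_self
  have hcs : ∀ s ∈ U, ContinuousOn (f s) (Set.Icc 0 1) := fun s hs =>
    hc.comp (Continuous.continuousOn (by fun_prop : Continuous fun x : ℝ => (s, x)))
      fun x hx => ⟨hs, hx⟩
  have hmeas : ∀ s ∈ U, MeasureTheory.AEStronglyMeasurable (f s)
      (MeasureTheory.volume.restrict (Set.uIoc (0 : ℝ) 1)) := fun s hs =>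
    ((hcs s hs).mono hIoc).aestronglyMeasurable measurableSet_uIoc
  have hderiv : ∀ x ∈ Set.uIoc (0 : ℝ) 1, ∀ s ∈ Metric.ball s₀ ρ,
      ‖deriv (fun s => f s x) s‖ ≤ M / ρ := by
    intro x hx s hs
    have hsub : Metric.closedBall s ρ ⊆ Metric.closedBall s₀ (2 * ρ) :=
      Metric.closedBall_subset_closedBall' (by linarith [Metric.mem_ball.1 hs])
    refine Complex.norm_deriv_le_of_forall_mem_sphere_norm_le hρ0 ?_ fun w hw =>
      hM (w, x) ⟨hsub (Metric.sphere_subset_closedBall hw), hIoc hx⟩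
    refine DifferentiableOn.diffContOnCl fun w hw => ?_
    rw [closure_ball _ hρ0.ne'] at hw
    exact (hd w (hK (hsub hw)) x (hIoc hx)).differentiableWithinAt
  -- the derivative is measurable, being a limit of difference quotients
  have hmeas' : MeasureTheory.AEStronglyMeasurable (fun x => deriv (fun s => f s x) s₀)
      (MeasureTheory.volume.restrict (Set.uIoc (0 : ℝ) 1)) := by
    set u : ℕ → ℂ := fun n => s₀ + (ρ / (n + 1) : ℝ) with hu
    have hun : ∀ n, u n ∈ U := fun n => hK <| by
      rw [Metric.mem_closedBall, dist_eq_norm, hu, add_sub_cancel_left, Complex.norm_real,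
        Real.norm_eq_abs, abs_of_pos (by positivity), div_le_iff₀ (by positivity)]
      have : (0 : ℝ) ≤ n := n.cast_nonneg
      nlinarith
    have hut : Tendsto u atTop (𝓝[≠] s₀) := by
      refine tendsto_nhdsWithin_iff.2 ⟨?_, Eventually.of_forall fun n => ?_⟩
      · have h1 : Tendsto (fun n : ℕ => ((ρ / (n + 1) : ℝ) : ℂ)) atTop (𝓝 ((0 : ℝ) : ℂ)) :=
          (Complex.continuous_ofReal.tendsto 0).comp (by
            simpa [div_eq_mul_inv] using
              (tendsto_one_div_add_atTop_nhds_zero_nat (𝕜 := ℝ)).const_mul ρ)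
        simpa [hu] using h1.const_add s₀
      · have : ((ρ / (n + 1) : ℝ) : ℂ) ≠ 0 := by
          rw [Complex.ofReal_ne_zero]; positivity
        simpa [hu] using this
    refine aestronglyMeasurable_of_tendsto_ae atTop
      (f := fun n x => slope (fun s => f s x) s₀ (u n)) (fun n => ?_) ?_
    · simp only [slope, vsub_eq_sub]
      have h := ((hmeas _ (hun n)).sub (hmeas _ hs₀)).const_smul ((u n - s₀)⁻¹)
      exact h
    · refine (MeasureTheory.ae_restrict_iff' measurableSet_uIoc).2 (Eventually.of_forall ?_)
      intro x hx
      exact (hasDerivAt_iff_tendsto_slope.1 (hd s₀ hs₀ x (hIoc hx)).hasDerivAt).comp hut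
  have hball' : Metric.ball s₀ ρ ⊆ U := fun s hs =>
    hK (Metric.ball_subset_closedBall.trans (Metric.closedBall_subset_closedBall (by linarith)) hs)
  exact (intervalIntegral.hasDerivAt_integral_of_dominated_loc_of_deriv_le
    (F' := fun s x => deriv (fun s => f s x) s) (bound := fun _ => M / ρ)
    (Metric.ball_mem_nhds s₀ hρ0)
    (by filter_upwards [hU.mem_nhds hs₀] with s hs using hmeas s hs)
    ((hcs s₀ hs₀).intervalIntegrable_of_Icc zero_le_one) hmeas'
    (Eventually.of_forall fun x hx s hs => hderiv x hx s hs) intervalIntegrable_const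
    (Eventually.of_forall fun x hx s hs =>
      (hd s (hball' hs) x (hIoc hx)).hasDerivAt)).2.differentiableAt

/-- The function `(s - 1) ζ(s, z)` on the half plane `1 - n < re s`, continued from `1 < re s` by
`n` applications of `(s - 1) ζ(s, z) = z ^ (1 - s) + (s - 1) ∫₀¹ (1 - x) s ζ(s + 1, z + x) dx`. -/
noncomputable def hurwitzAux : ℕ → ℂ → ℂ → ℂ
  | 0, s, z => (s - 1) * ∑' k, hurwitzTerm z k s
  | n + 1, s, z => z ^ (1 - s) + (s - 1) * ∫ x in (0 : ℝ)..1, (1 - x) * hurwitzAux n (s + 1) (z + x)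

/-- The corrected `q`-series converges to `hurwitzAux n s z / (s - 1)` at every noninteger `s` of
the half plane. -/
lemma tendsto_correctedSeries (n : ℕ) {s₀ z₀ : ℂ} (hs : s₀ ∈ nonintegers) (hn : 1 - n < s₀.re)
    (hz : 0 < z₀.re) :
    Tendsto (fun p : ℝ × ℂ × ℂ => correctedSeries p.1 p.2.1 p.2.2) (𝓝[<] 0 ×ˢ 𝓝 (s₀, z₀))
      (𝓝 (hurwitzAux n s₀ z₀ / (s₀ - 1))) := by
  induction n generalizing s₀ z₀ with
  | zero =>
    have h1 : s₀ - 1 ≠ 0 := sub_ne_zero.2 (by simpa using hs 1)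
    have h := tendsto_correctedSeries_of_one_lt_re hs (by simpa using hn) hz
    rwa [hurwitzAux, mul_div_cancel_left₀ _ h1]
  | succ n ih =>
    have h0 : s₀ ≠ 0 := by simpa using hs 0
    have h1 : s₀ - 1 ≠ 0 := sub_ne_zero.2 (by simpa using hs 1)
    have h := tendsto_correctedSeries_of_add_one hs hz
      (H := fun z => hurwitzAux n (s₀ + 1) z / s₀) fun z hz' => by
        have := ih (s₀ := s₀ + 1) (z₀ := z) (add_one_mem_nonintegers hs)
          (by push_cast at hn; simp; linarith) hz'
        rwa [add_sub_cancel_right] at this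
    convert! h using 2
    have h2 : (fun x : ℝ => ((1 : ℂ) - x) * (hurwitzAux n (s₀ + 1) (z₀ + x) / s₀)) =
        fun x : ℝ => s₀⁻¹ * ((1 - x) * hurwitzAux n (s₀ + 1) (z₀ + x)) := by
      funext x; ring
    rw [hurwitzAux, h2, intervalIntegral.integral_const_mul]
    field_simp

lemma norm_hurwitzTerm_le (k : ℕ) {s z : ℂ} (hs : 0 ≤ s.re) (hz : 0 < z.re) :
    ‖hurwitzTerm z k s‖ ≤ Real.exp (Real.pi * |s.im|) * (k + z.re) ^ (-s.re) := by
  have h := norm_cpow_neg_le (v := k + z) (add_pos_of_nonneg_of_pos k.cast_nonneg hz)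
    (by simpa using Complex.re_le_norm (k + z)) hs
  rwa [hurwitzTerm, one_div, ← Complex.cpow_neg, mul_comm (Real.exp _)]

/-- Joint continuity in `(s, z)` is part of the induction: it is what allows the integral over
`z + [0, 1]` to be differentiated in `s`. -/
lemma continuousAt_hurwitzAux_and_differentiableAt (n : ℕ) {s₀ z₀ : ℂ} (hn : 1 - n < s₀.re)
    (hz : 0 < z₀.re) :
    ContinuousAt (fun p : ℂ × ℂ => hurwitzAux n p.1 p.2) (s₀, z₀) ∧
      DifferentiableAt ℂ (fun s => hurwitzAux n s z₀) s₀ := by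
  induction n generalizing s₀ z₀ with
  | zero =>
    obtain ⟨u, hu, hb⟩ := exists_summable_bound (s₀ := s₀) (by simpa using hn) hz
    have hb' : ∀ᶠ p in 𝓝 (s₀, z₀), ∀ k : ℕ, 0 < p.2.re ∧ ‖hurwitzTerm p.2 k p.1‖ ≤ u k := by
      filter_upwards [hb] with p hp k
      obtain ⟨h1, h2, h3⟩ := hp k 0 (by norm_num)
      exact ⟨h2, (norm_hurwitzTerm_le k (by linarith) h2).trans (by simpa using h3)⟩
    have hslit : ∀ k : ℕ, ∀ z : ℂ, 0 < z.re → (k : ℂ) + z ∈ Complex.slitPlane := fun k z hz => by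
      left; simpa using add_pos_of_nonneg_of_pos k.cast_nonneg hz
    constructor
    · have h : Tendsto (fun p : ℂ × ℂ => ∑' k, hurwitzTerm p.2 k p.1) (𝓝 (s₀, z₀))
          (𝓝 (∑' k, hurwitzTerm z₀ k s₀)) := by
        refine tendsto_tsum_of_dominated_convergence hu (fun k => ?_)
          (hb'.mono fun p h k => (h k).2)
        have h1 : ContinuousAt (fun p : ℂ × ℂ => ((k : ℂ) + p.2) ^ p.1) (s₀, z₀) :=
          ContinuousAt.cpow (by fun_prop) (by fun_prop) (hslit k z₀ hz)
        have h2 : ((k : ℂ) + z₀) ^ s₀ ≠ 0 := by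
          simp [Complex.cpow_eq_zero_iff, Complex.slitPlane_ne_zero (hslit k z₀ hz)]
        exact (continuousAt_const.div h1 h2).tendsto
      exact (by fun_prop : ContinuousAt (fun p : ℂ × ℂ => p.1 - 1) (s₀, z₀)).mul h
    · have h1 : ∀ᶠ s in 𝓝 s₀, ∀ k : ℕ, ‖hurwitzTerm z₀ k s‖ ≤ u k := by
        have hcont : Tendsto (fun s : ℂ => (s, z₀)) (𝓝 s₀) (𝓝 (s₀, z₀)) :=
          Continuous.tendsto (by fun_prop) s₀
        exact (hcont.eventually hb').mono fun s h k => (h k).2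
      obtain ⟨V, hV, hVo, hmem⟩ := eventually_nhds_iff.1 h1
      have h2 := Complex.differentiableOn_tsum_of_summable_norm (F := fun k s => hurwitzTerm z₀ k s)
        hu (fun k => ?_) hVo fun k s hs => hV s hs k
      · exact ((differentiableAt_id.sub_const 1).mul
          (h2.differentiableAt (hVo.mem_nhds hmem)) :)
      · intro s _
        have h3 : (k : ℂ) + z₀ ≠ 0 := Complex.slitPlane_ne_zero (hslit k z₀ hz)
        have h4 : DifferentiableAt ℂ (fun s : ℂ => ((k : ℂ) + z₀) ^ s) s :=
          differentiableAt_id.const_cpow (Or.inl h3)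
        exact ((differentiableAt_const 1).div h4
          (by simp [Complex.cpow_eq_zero_iff, h3])).differentiableWithinAt
  | succ n ih =>
    push_cast at hn
    have hre : ∀ {s : ℂ}, 1 - (n + 1 : ℝ) < s.re → 1 - (n : ℝ) < (s + 1).re := by
      intro s hs; simp; linarith
    have hzx : ∀ {z : ℂ} {x : ℝ}, 0 < z.re → x ∈ Set.Icc (0 : ℝ) 1 → 0 < (z + x).re := by
      intro z x hz hx; simpa using add_pos_of_pos_of_nonneg hz hx.1
    have hcomp : ∀ {s z : ℂ} {x : ℝ}, 1 - (n + 1 : ℝ) < s.re → 0 < z.re → x ∈ Set.Icc (0 : ℝ) 1 →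
        ContinuousAt (fun p : (ℂ × ℂ) × ℝ => (1 - p.2) * hurwitzAux n (p.1.1 + 1) (p.1.2 + p.2))
          ((s, z), x) := by
      intro s z x hs hz hx
      have h1 := (ih (hre hs) (hzx hz hx)).1
      have h2 : ContinuousAt (fun p : (ℂ × ℂ) × ℝ => ((p.1.1 + 1, p.1.2 + p.2) : ℂ × ℂ))
        ((s, z), x) := by fun_prop
      have h3 : ContinuousAt (fun p : (ℂ × ℂ) × ℝ => hurwitzAux n (p.1.1 + 1) (p.1.2 + p.2))
        ((s, z), x) := ContinuousAt.comp (g := fun q : ℂ × ℂ => hurwitzAux n q.1 q.2)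
          (f := fun p : (ℂ × ℂ) × ℝ => ((p.1.1 + 1, p.1.2 + p.2) : ℂ × ℂ)) h1 h2
      exact (by fun_prop : ContinuousAt (fun p : (ℂ × ℂ) × ℝ => (1 - p.2 : ℂ)) ((s, z), x)).mul h3
    have hUo : IsOpen {s : ℂ | 1 - (n + 1 : ℝ) < s.re} :=
      isOpen_lt continuous_const Complex.continuous_re
    constructor
    · have h1 : Tendsto (fun p : ℂ × ℂ => ∫ x in (0 : ℝ)..1,
          (1 - x) * hurwitzAux n (p.1 + 1) (p.2 + x)) (𝓝 (s₀, z₀))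
          (𝓝 (∫ x in (0 : ℝ)..1, (1 - x) * hurwitzAux n (s₀ + 1) (z₀ + x))) := by
        refine tendsto_intervalIntegral_of_tendsto_prod (zero_le_one' ℝ) (fun x hx => ?_) ?_
        · have h2 := (hcomp hn hz hx).tendsto
          rw [nhds_prod_eq] at h2
          exact h2.mono_left (prod_mono le_rfl nhdsWithin_le_nhds)
        · have e1 : ∀ᶠ p : ℂ × ℂ in 𝓝 (s₀, z₀), 1 - (n + 1 : ℝ) < p.1.re :=
            (Continuous.tendsto (by fun_prop : Continuous fun p : ℂ × ℂ => p.1.re)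
              (s₀, z₀)).eventually_const_lt hn
          have e2 : ∀ᶠ p : ℂ × ℂ in 𝓝 (s₀, z₀), 0 < p.2.re :=
            (Continuous.tendsto (by fun_prop : Continuous fun p : ℂ × ℂ => p.2.re)
              (s₀, z₀)).eventually_const_lt hz
          filter_upwards [e1, e2] with p h3 h4 x hx
          exact (ContinuousAt.comp (f := fun x : ℝ => (((p.1, p.2), x) : (ℂ × ℂ) × ℝ))
            (hcomp h3 h4 hx) (by fun_prop)).continuousWithinAt
      have h5 : ContinuousAt (fun p : ℂ × ℂ => p.2 ^ (1 - p.1)) (s₀, z₀) :=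
        ContinuousAt.cpow (by fun_prop) (by fun_prop) (Or.inl hz)
      exact h5.add ((by fun_prop : ContinuousAt (fun p : ℂ × ℂ => p.1 - 1) (s₀, z₀)).mul h1)
    · have h1 : DifferentiableAt ℂ (fun s => ∫ x in (0 : ℝ)..1,
          (1 - x) * hurwitzAux n (s + 1) (z₀ + x)) s₀ := by
        refine differentiableAt_intervalIntegral hUo hn (fun s hs x hx => ?_) fun p hp => ?_
        · have h2 := (ih (hre hs) (hzx hz hx)).2
          exact (DifferentiableAt.comp s (g := fun w => hurwitzAux n w (z₀ + x)) h2
            (differentiableAt_id.add_const 1)).const_mul _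
        · exact (ContinuousAt.comp (f := fun p : ℂ × ℝ => (((p.1, z₀), p.2) : (ℂ × ℂ) × ℝ))
            (hcomp hp.1 hz hp.2) (by fun_prop)).continuousWithinAt
      have hz0 : z₀ ≠ 0 := by rintro rfl; simp at hz
      have h5 : DifferentiableAt ℂ (fun s : ℂ => z₀ ^ (1 - s)) s₀ :=
        (differentiableAt_id.const_sub 1).const_cpow (Or.inl hz0)
      exact h5.add ((differentiableAt_id.sub_const 1).mul h1)

lemma dense_nonintegers : Dense nonintegers := by
  rw [nonintegers_eq]
  exact (Set.countable_range _).dense_compl ℝ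

/-- The continuations to the various half planes are compatible. -/
lemma hurwitzAux_succ_eq (n : ℕ) {s z : ℂ} (hn : 1 - n < s.re) (hz : 0 < z.re) :
    hurwitzAux (n + 1) s z = hurwitzAux n s z := by
  induction n generalizing s z with
  | zero =>
    -- both are limits of the `q`-series at nonintegers; integers are reached by continuity
    have h1 := (continuousAt_hurwitzAux_and_differentiableAt 1 (s₀ := s)
      (by simp at hn ⊢; linarith) hz).2.continuousAt
    have h2 := (continuousAt_hurwitzAux_and_differentiableAt 0 hn hz).2.continuousAt
    refine tendsto_nhds_unique_of_frequently_eq h1 h2 ?_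
    have h3 : ∀ᶠ w in 𝓝 s, 1 < w.re :=
      Complex.continuous_re.continuousAt.eventually_const_lt (by simpa using hn)
    refine ((mem_closure_iff_frequently.1 (dense_nonintegers s)).and_eventually h3).mono ?_
    rintro w ⟨hw, hw1⟩
    have hw0 : w - 1 ≠ 0 := sub_ne_zero.2 (by simpa using hw 1)
    have h := tendsto_nhds_unique (tendsto_correctedSeries 1 hw (by simp; linarith) hz)
      (tendsto_correctedSeries 0 hw (by simpa using hw1) hz)
    exact (div_left_inj' hw0).1 h
  | succ n ih =>
    rw [hurwitzAux, hurwitzAux]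
    congr 2
    refine intervalIntegral.integral_congr fun x hx => ?_
    rw [Set.uIcc_of_le zero_le_one] at hx
    rw [ih (by push_cast at hn; simp; linarith) (by simpa using add_pos_of_pos_of_nonneg hz hx.1)]

/-- The entire function `s ↦ (s - 1) ζ(s, z)`: at each `s` a half plane containing it is chosen. -/
noncomputable def hurwitzEntire (s z : ℂ) : ℂ := hurwitzAux (⌈1 - s.re⌉₊ + 1) s z

lemma hurwitzEntire_eq (n : ℕ) {s z : ℂ} (hn : 1 - n < s.re) (hz : 0 < z.re) :
    hurwitzEntire s z = hurwitzAux n s z := by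
  have key : ∀ m k : ℕ, 1 - (m : ℝ) < s.re → hurwitzAux (m + k) s z = hurwitzAux m s z := by
    intro m k hm
    induction k with
    | zero => rfl
    | succ k ih =>
      rw [← add_assoc, hurwitzAux_succ_eq _ (by
        push_cast
        have : (0 : ℝ) ≤ k := k.cast_nonneg
        linarith) hz, ih]
  have h1 : 1 - ((⌈1 - s.re⌉₊ + 1 : ℕ) : ℝ) < s.re := by
    have := Nat.le_ceil (1 - s.re)
    push_cast
    linarith
  rw [hurwitzEntire, ← key _ n h1, add_comm, key n _ hn]

lemma differentiable_hurwitzEntire {z : ℂ} (hz : 0 < z.re) :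
    Differentiable ℂ fun s => hurwitzEntire s z := by
  intro s
  have hn : 1 - ((⌈1 - s.re⌉₊ + 1 : ℕ) : ℝ) < s.re := by
    have := Nat.le_ceil (1 - s.re)
    push_cast
    linarith
  refine (continuousAt_hurwitzAux_and_differentiableAt _ hn hz).2.congr_of_eventuallyEq ?_
  filter_upwards [Complex.continuous_re.continuousAt.eventually_const_lt hn] with w hw
  exact hurwitzEntire_eq _ hw hz

/-- The residue of the Hurwitz zeta function at `s = 1` is `1`; in particular `s = 1` is a genuine
pole, and the value `0` which division by zero gives there is the normal form value. -/
lemma hurwitzEntire_one {z : ℂ} (hz : 0 < z.re) : hurwitzEntire 1 z = 1 := by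
  rw [hurwitzEntire_eq 1 (by simp) hz, hurwitzAux]
  simp

lemma isSeriesContinuation_hurwitz {z : ℂ} (hz : 0 < z.re) :
    IsSeriesContinuation (hurwitzTerm z) 1 (fun s => hurwitzEntire s z / (s - 1)) where
  meromorphic := by
    intro s _
    have ha : AnalyticAt ℂ (fun s => hurwitzEntire s z) s :=
      (differentiable_hurwitzEntire hz).analyticAt s
    rcases eq_or_ne s 1 with rfl | hs
    · refine Or.inr ⟨-1, fun s => hurwitzEntire s z, ha, by simp [hurwitzEntire_one hz],
        Eventually.of_forall fun w => ?_⟩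
      simp [div_eq_inv_mul]
    · exact (ha.div (analyticAt_id.sub analyticAt_const) (sub_ne_zero.2 hs)).meromorphicNFAt
  hasSum := by
    intro s hs
    have h1 : s - 1 ≠ 0 := sub_ne_zero.2 (by rintro rfl; simp at hs)
    rw [hurwitzEntire_eq 0 (by simpa using hs) hz, hurwitzAux, mul_div_cancel_left₀ _ h1]
    obtain ⟨u, hu, hb⟩ := exists_summable_bound hs hz
    refine (Summable.of_norm_bounded hu fun k => ?_).hasSum
    obtain ⟨-, -, h3⟩ := hb.self_of_nhds k 0 (by norm_num)
    exact (norm_hurwitzTerm_le k (by linarith) hz).trans (by simpa using h3)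

/-! ### Continuation of the `q`-Hurwitz zeta function and cancellation of its poles -/

lemma analyticAt_one_sub_exp_inv {ℓ : ℝ} {s : ℂ} {r : ℕ} (h : Complex.exp (ℓ * (s + r)) ≠ 1) :
    AnalyticAt ℂ (fun s : ℂ => (1 - Complex.exp (ℓ * (s + r)))⁻¹) s :=
  AnalyticAt.inv (by fun_prop) (sub_ne_zero.2 h.symm)

/-- The series `qSeries` without its term of index `m`. -/
noncomputable def qSeriesErase (m : ℕ) (ℓ : ℝ) (s t : ℂ) : ℂ :=
  ∑' r : ℕ, risingCoeff s r * (if r = m then 0 else (1 - Complex.exp (ℓ * (s + r)))⁻¹) * t ^ r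

lemma qSeries_eq_add_erase (m : ℕ) {ℓ : ℝ} (hℓ : ℓ < 0) (s : ℂ) {t : ℂ} (ht : ‖t‖ < 1) :
    qSeries ℓ s t = risingCoeff s m * (1 - Complex.exp (ℓ * (s + m)))⁻¹ * t ^ m +
      qSeriesErase m ℓ s t := by
  rw [qSeries, ((discSummable_qSeries hℓ s).summable ht).tsum_eq_add_tsum_ite m, qSeriesErase]
  congr 1
  refine tsum_congr fun r => ?_
  split_ifs <;> simp

lemma analyticAt_qSeriesErase {m : ℕ} {ℓ : ℝ} (hℓ : ℓ < 0) {s₀ : ℂ}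
    (h : ∀ r : ℕ, r ≠ m → Complex.exp (ℓ * (s₀ + r)) ≠ 1) {t : ℂ} (ht : ‖t‖ < 1) :
    AnalyticAt ℂ (fun s => qSeriesErase m ℓ s t) s₀ := by
  refine analyticAt_tsum_risingCoeff (C := 2) ht (fun r => ?_) ?_
  · by_cases hr : r = m
    · simpa [hr] using analyticAt_const
    · simpa [hr] using analyticAt_one_sub_exp_inv (h r hr)
  · filter_upwards [(tendsto_exp_add_natCast hℓ s₀).norm.eventually_le_const
      (by norm_num : ‖(0 : ℂ)‖ < 1 / 2)] with p hp
    have h1 : Complex.exp (ℓ * (p.1 + p.2)) ≠ 1 := fun h1 => by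
      rw [h1] at hp; norm_num at hp
    by_cases hr : p.2 = m
    · simp [hr]
    · simp only [hr, if_false]
      refine ⟨(analyticAt_one_sub_exp_inv h1).differentiableAt, ?_⟩
      have h2 := norm_sub_norm_le (1 : ℂ) (Complex.exp (ℓ * (p.1 + p.2)))
      rw [norm_one] at h2
      rw [norm_inv, inv_le_comm₀ (by linarith) two_pos]
      linarith

lemma analyticAt_qSeries {ℓ : ℝ} (hℓ : ℓ < 0) {s₀ : ℂ}
    (h : ∀ r : ℕ, Complex.exp (ℓ * (s₀ + r)) ≠ 1) {t : ℂ} (ht : ‖t‖ < 1) :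
    AnalyticAt ℂ (fun s => qSeries ℓ s t) s₀ := by
  simp only [qSeries_eq_add_erase 0 hℓ _ ht]
  have h1 : AnalyticAt ℂ (fun s => risingCoeff s 0) s₀ := by
    simpa using analyticAt_const
  exact ((h1.mul (analyticAt_one_sub_exp_inv (h 0))).mul analyticAt_const).add
    (analyticAt_qSeriesErase hℓ (fun r _ => h r) ht)

lemma analyticAt_risingCoeff (r : ℕ) (s₀ : ℂ) : AnalyticAt ℂ (fun s => risingCoeff s r) s₀ := by
  have : Differentiable ℂ fun s => risingCoeff s r := by unfold risingCoeff; fun_prop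
  exact this.analyticAt s₀

/-- At most one term of the series has a pole at a given point, because `|q ^ (s + r)|` is strictly
monotone in `r`. -/
lemma meromorphicAt_qSeries {ℓ : ℝ} (hℓ : ℓ < 0) (s₀ : ℂ) {t : ℂ} (ht : ‖t‖ < 1) :
    MeromorphicAt (fun s => qSeries ℓ s t) s₀ := by
  by_cases h : ∃ m : ℕ, Complex.exp (ℓ * (s₀ + m)) = 1
  · obtain ⟨m, hm⟩ := h
    have hr : ∀ r : ℕ, r ≠ m → Complex.exp (ℓ * (s₀ + r)) ≠ 1 := by
      intro r hrm hr
      refine hrm ?_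
      have h1 : Complex.exp (ℓ * (s₀ + r)) = Complex.exp (ℓ * (s₀ + m)) := hr.trans hm.symm
      have h2 := congrArg norm h1
      simp only [Complex.norm_exp] at h2
      have h3 := Real.exp_injective h2
      simp [hℓ.ne] at h3
      exact h3
    simp only [qSeries_eq_add_erase m hℓ _ ht]
    have h1 : AnalyticAt ℂ (fun s : ℂ => 1 - Complex.exp (ℓ * (s + m))) s₀ := by fun_prop
    exact (((analyticAt_risingCoeff m s₀).meromorphicAt.mul h1.meromorphicAt.inv).mul
      (MeromorphicAt.const _ _)).add (analyticAt_qSeriesErase hℓ hr ht).meromorphicAt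
  · push Not at h
    exact (analyticAt_qSeries hℓ h ht).meromorphicAt

/-- The explicit continuation of the `q`-Hurwitz zeta function, for `q = exp ℓ`. At the possible
poles its values are those of division by zero and carry no meaning. -/
noncomputable def qHurwitzExplicit (ℓ : ℝ) (z s : ℂ) : ℂ :=
  Complex.exp (ℓ * s) * ((1 - Complex.exp ℓ) ^ s * qSeries ℓ s (Complex.exp (ℓ * z)))

lemma analyticAt_prefactor {ℓ : ℝ} (hℓ : ℓ < 0) (s : ℂ) :
    AnalyticAt ℂ (fun s : ℂ => Complex.exp (ℓ * s) * (1 - Complex.exp ℓ) ^ s) s := by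
  have h : Differentiable ℂ fun s : ℂ => Complex.exp (ℓ * s) * (1 - Complex.exp ℓ) ^ s :=
    Differentiable.mul (by fun_prop) fun s =>
      differentiableAt_id.const_cpow (Or.inl (one_sub_exp_ne_zero hℓ))
  exact h.analyticAt s

lemma analyticAt_qHurwitzExplicit {ℓ : ℝ} (hℓ : ℓ < 0) {z : ℂ} (hz : 0 < z.re) {s : ℂ}
    (h : ∀ r : ℕ, Complex.exp (ℓ * (s + r)) ≠ 1) : AnalyticAt ℂ (qHurwitzExplicit ℓ z) s := by
  have h1 := (analyticAt_prefactor hℓ s).mul (analyticAt_qSeries hℓ h (norm_exp_mul_lt_one hℓ hz))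
  refine h1.congr (Eventually.of_forall fun w => ?_)
  simp [qHurwitzExplicit, mul_assoc]

lemma meromorphicOn_qHurwitzExplicit {ℓ : ℝ} (hℓ : ℓ < 0) {z : ℂ} (hz : 0 < z.re) :
    MeromorphicOn (qHurwitzExplicit ℓ z) Set.univ := by
  intro s _
  have h1 := (analyticAt_prefactor hℓ s).meromorphicAt.mul
    (meromorphicAt_qSeries hℓ s (norm_exp_mul_lt_one hℓ hz))
  refine h1.congr (Eventually.of_forall fun w => ?_)
  simp [qHurwitzExplicit, mul_assoc]

lemma ofReal_cpow_eq_exp {q : ℝ} (hq : 0 < q) (w : ℂ) :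
    (q : ℂ) ^ w = Complex.exp (Real.log q * w) := by
  rw [Complex.cpow_def_of_ne_zero (by exact_mod_cast hq.ne'), Complex.ofReal_log hq.le]

lemma exp_ofReal_log {q : ℝ} (hq : 0 < q) : Complex.exp (Real.log q : ℝ) = q := by
  rw [← Complex.ofReal_exp, Real.exp_log hq]

lemma qHurwitzTerm_eq {q : ℝ} (h0 : 0 < q) (h1 : q < 1) (z : ℂ) (k : ℕ) (s : ℂ) :
    qHurwitzTerm q z k s = Complex.exp (Real.log q * s) * qTerm k (Real.log q) s z := by
  have hℓ := Real.log_neg h0 h1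
  have hn : qNumber q (k + z) = (k + z) * expSlope (Real.log q * (k + z)) /
      expSlope (Real.log q) := by
    rw [qNumber, ofReal_cpow_eq_exp h0, one_sub_exp_mul, neg_ofReal_eq hℓ, Real.exp_log h0]
    have h2 : (1 - q : ℂ) ≠ 0 := by exact_mod_cast (sub_pos.2 h1).ne'
    have h3 := expSlope_ofReal_ne_zero hℓ
    push_cast
    field_simp
  have he : Complex.exp (Real.log q * (s * (k + 1))) =
      Complex.exp (Real.log q * s) * Complex.exp (Real.log q * s * k) := by
    rw [← Complex.exp_add]; ring_nf
  rw [qHurwitzTerm, hn, qTerm, ofReal_cpow_eq_exp h0, Complex.cpow_neg, he, div_eq_mul_inv,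
    mul_assoc]

/-- The continuation in normal form. -/
lemma isSeriesContinuation_qHurwitz {q : ℝ} (h0 : 0 < q) (h1 : q < 1) {z : ℂ} (hz : 0 < z.re) :
    IsSeriesContinuation (qHurwitzTerm q z) 0
      (toMeromorphicNFOn (qHurwitzExplicit (Real.log q) z) Set.univ) where
  meromorphic := meromorphicNFOn_toMeromorphicNFOn _ _
  hasSum := by
    intro s hs
    have hℓ := Real.log_neg h0 h1
    have ha : AnalyticAt ℂ (qHurwitzExplicit (Real.log q) z) s := by
      refine analyticAt_qHurwitzExplicit hℓ hz fun r hr => ?_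
      have h2 := norm_exp_mul_lt_one hℓ (z := s + r)
        (by simpa using add_pos_of_pos_of_nonneg hs r.cast_nonneg)
      rw [hr, norm_one] at h2
      exact lt_irrefl _ h2
    rw [toMeromorphicNFOn_eq_toMeromorphicNFAt (meromorphicOn_qHurwitzExplicit hℓ hz)
      (Set.mem_univ s), toMeromorphicNFAt_eq_self.2 ha.meromorphicNFAt]
    exact ((hasSum_qTerm hℓ hs hz).mul_left (Complex.exp (Real.log q * s))).congr_fun fun k =>
      qHurwitzTerm_eq h0 h1 z k s

lemma qHurwitzZeta_eq {q : ℝ} (h0 : 0 < q) (h1 : q < 1) {z : ℂ} (hz : 0 < z.re) {s : ℂ}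
    (h : ∀ r : ℕ, Complex.exp (Real.log q * (s + r)) ≠ 1) :
    qHurwitzZeta q z s = qHurwitzExplicit (Real.log q) z s := by
  have hℓ := Real.log_neg h0 h1
  rw [qHurwitzZeta, (isSeriesContinuation_qHurwitz h0 h1 hz).eq_seriesContinuation,
    toMeromorphicNFOn_eq_toMeromorphicNFAt (meromorphicOn_qHurwitzExplicit hℓ hz) (Set.mem_univ s),
    toMeromorphicNFAt_eq_self.2 (analyticAt_qHurwitzExplicit hℓ hz h).meromorphicNFAt]

lemma analyticAt_qHurwitzZeta {q : ℝ} (h0 : 0 < q) (h1 : q < 1) {z : ℂ} (hz : 0 < z.re) {s : ℂ}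
    (h : ∀ r : ℕ, Complex.exp (Real.log q * (s + r)) ≠ 1) :
    AnalyticAt ℂ (qHurwitzZeta q z) s := by
  have hℓ := Real.log_neg h0 h1
  have ha := analyticAt_qHurwitzExplicit hℓ hz h
  refine ha.congr ?_
  filter_upwards [ha.eventually_analyticAt] with w hw
  rw [qHurwitzZeta, (isSeriesContinuation_qHurwitz h0 h1 hz).eq_seriesContinuation,
    toMeromorphicNFOn_eq_toMeromorphicNFAt (meromorphicOn_qHurwitzExplicit hℓ hz) (Set.mem_univ w),
    toMeromorphicNFAt_eq_self.2 hw.meromorphicNFAt]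

/-- Off the poles the corrected zeta function is `q ^ s` times the corrected series. -/
lemma correctedQHurwitzZeta_eq {q : ℝ} (h0 : 0 < q) (h1 : q < 1) {z : ℂ} (hz : 0 < z.re) {s : ℂ}
    (h : ∀ r : ℕ, Complex.exp (Real.log q * (s + r)) ≠ 1) :
    correctedQHurwitzZeta q z s =
      Complex.exp (Real.log q * s) * correctedSeries (Real.log q) s z := by
  have h2 : ((q : ℂ) - (q : ℂ) ^ 2) ^ s = (q : ℂ) ^ s * (1 - q) ^ s := by
    rw [← ofReal_mul_cpow h0]; ring_nf
  rw [correctedQHurwitzZeta, qHurwitzZeta_eq h0 h1 hz h, qHurwitzExplicit, correctedSeries,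
    balancedSeries, h2, ofReal_cpow_eq_exp h0, ofReal_cpow_eq_exp h0, exp_ofReal_log h0,
    show (Real.log q : ℂ) * (-z * s) = -(Real.log q * s * z) by ring]
  rw [← div_div]
  ring

lemma risingCoeff_neg_self (m : ℕ) : risingCoeff (-m) m = (-1) ^ m := by
  induction m with
  | zero => simp
  | succ m ih =>
    have h := succ_mul_risingCoeff_succ (-((m + 1 : ℕ) : ℂ)) m
    have h1 : (m : ℂ) + 1 ≠ 0 := Nat.cast_add_one_ne_zero m
    rw [show -((m + 1 : ℕ) : ℂ) + 1 = -m by push_cast; ring, ih] at h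
    apply mul_left_cancel₀ h1
    rw [h]
    push_cast
    ring

lemma analyticAt_correctedSeries {ℓ : ℝ} (hℓ : ℓ < 0) {z : ℂ} (hz : 0 < z.re) {s : ℂ}
    (hs : s ∈ nonintegers) (h : ∀ r : ℕ, Complex.exp (ℓ * (s + r)) ≠ 1) :
    AnalyticAt ℂ (fun s => Complex.exp (ℓ * s) * correctedSeries ℓ s z) s := by
  have hℓ0 : (ℓ : ℂ) ≠ 0 := by exact_mod_cast hℓ.ne
  have h1 : AnalyticAt ℂ (fun s : ℂ => Complex.exp (-(ℓ * s * z)) *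
      (Real.pi / (ℓ * Complex.sin (Real.pi * s)))) s :=
    AnalyticAt.mul (by fun_prop) (AnalyticAt.div (by fun_prop) (by fun_prop)
      (mul_ne_zero hℓ0 (sin_pi_mul_ne_zero_of_mem hs)))
  have h2 := (analyticAt_prefactor hℓ s).mul
    ((analyticAt_qSeries hℓ h (norm_exp_mul_lt_one hℓ hz)).add h1)
  refine h2.congr (Eventually.of_forall fun w => ?_)
  simp [correctedSeries, balancedSeries, mul_assoc]

/-- The residues at `s = -m` cancel. -/
lemma tendsto_mul_correctedSeries {ℓ : ℝ} (hℓ : ℓ < 0) {z : ℂ} (hz : 0 < z.re) (m : ℕ) :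
    Tendsto (fun s : ℂ => (s + m) * (Complex.exp (ℓ * s) * correctedSeries ℓ s z))
      (𝓝[≠] (-(m : ℂ))) (𝓝 0) := by
  have hℓ0 : (ℓ : ℂ) ≠ 0 := by exact_mod_cast hℓ.ne
  have ht := norm_exp_mul_lt_one hℓ hz
  have hpi : (Real.pi : ℂ) ≠ 0 := by exact_mod_cast Real.pi_ne_zero
  have hu : Tendsto (fun s : ℂ => s + m) (𝓝[≠] (-(m : ℂ))) (𝓝[≠] 0) := by
    refine tendsto_nhdsWithin_iff.2 ⟨?_, ?_⟩
    · refine Tendsto.mono_left ?_ nhdsWithin_le_nhds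
      exact Continuous.tendsto' (by fun_prop) _ _ (by simp)
    · filter_upwards [self_mem_nhdsWithin] with s hs
      exact fun h => hs (eq_neg_of_add_eq_zero_left h)
  have hu0 := hu.mono_right nhdsWithin_le_nhds
  -- the pole of the power series
  have t1 : Tendsto (fun s : ℂ => risingCoeff s m * (-(ℓ * expSlope (ℓ * (s + m))))⁻¹ *
      Complex.exp (ℓ * z) ^ m) (𝓝[≠] (-(m : ℂ)))
      (𝓝 ((-1) ^ m * (-(ℓ : ℂ))⁻¹ * Complex.exp (ℓ * z) ^ m)) := by
    have h1 : Tendsto (fun s : ℂ => risingCoeff s m) (𝓝[≠] (-(m : ℂ))) (𝓝 ((-1) ^ m)) := by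
      rw [← risingCoeff_neg_self]
      exact (analyticAt_risingCoeff m _).continuousAt.tendsto.mono_left nhdsWithin_le_nhds
    have h2 := tendsto_expSlope (by simpa using hu0.const_mul (ℓ : ℂ))
    have h3 := ((h2.const_mul (ℓ : ℂ)).neg).inv₀ (by simpa using hℓ0)
    simpa using (h1.mul h3).mul_const (Complex.exp (ℓ * z) ^ m)
  have t2 : Tendsto (fun s : ℂ => (s + m) * qSeriesErase m ℓ s (Complex.exp (ℓ * z)))
      (𝓝[≠] (-(m : ℂ))) (𝓝 0) := by
    have h1 := (analyticAt_qSeriesErase (m := m) hℓ (s₀ := -(m : ℂ)) (fun r hr => ?_)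
      ht).continuousAt.tendsto.mono_left (nhdsWithin_le_nhds (s := {-(m : ℂ)}ᶜ))
    · simpa using hu0.mul h1
    · refine exp_mul_add_ne_one hℓ.ne (fun h => hr ?_) (by simp [Real.pi_pos])
      have : (r : ℂ) = m := by linear_combination h
      exact_mod_cast this
  -- the pole of the correction
  have t3 : Tendsto (fun s : ℂ => Complex.exp (-(ℓ * s * z)) * ((-1) ^ m * (Real.pi / ℓ)) *
      ((s + m)⁻¹ * Complex.sin (Real.pi * (s + m)))⁻¹) (𝓝[≠] (-(m : ℂ)))
      (𝓝 (Complex.exp (ℓ * z) ^ m * ((-1) ^ m * (Real.pi / ℓ)) * (Real.pi : ℂ)⁻¹)) := by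
    have h1 : HasDerivAt (fun u : ℂ => Complex.sin (Real.pi * u)) Real.pi 0 := by
      simpa using ((hasDerivAt_id (0 : ℂ)).const_mul (Real.pi : ℂ)).csin
    have h2 : Tendsto (fun u : ℂ => u⁻¹ * Complex.sin (Real.pi * u)) (𝓝[≠] 0) (𝓝 Real.pi) := by
      simpa using hasDerivAt_iff_tendsto_slope_zero.1 h1
    have h3 : Tendsto (fun s : ℂ => Complex.exp (-(ℓ * s * z))) (𝓝[≠] (-(m : ℂ)))
        (𝓝 (Complex.exp (ℓ * z) ^ m)) := by
      refine Tendsto.mono_left ?_ nhdsWithin_le_nhds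
      refine Continuous.tendsto' (by fun_prop) _ _ ?_
      rw [← Complex.exp_nat_mul]; ring_nf
    exact (h3.mul_const _).mul ((h2.comp hu).inv₀ hpi)
  have t4 : Tendsto (fun s : ℂ => Complex.exp (ℓ * s) * (1 - Complex.exp ℓ) ^ s)
      (𝓝[≠] (-(m : ℂ))) (𝓝 _) :=
    (analyticAt_prefactor hℓ _).continuousAt.tendsto.mono_left nhdsWithin_le_nhds
  have t5 := t4.mul ((t1.add t2).add t3)
  have e : (-1) ^ m * (-(ℓ : ℂ))⁻¹ * Complex.exp (ℓ * z) ^ m + 0 +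
      Complex.exp (ℓ * z) ^ m * ((-1) ^ m * (Real.pi / ℓ)) * (Real.pi : ℂ)⁻¹ = 0 := by
    field_simp
    ring
  rw [e, mul_zero] at t5
  refine t5.congr' ?_
  filter_upwards [self_mem_nhdsWithin] with s hs
  have hs0 : s + m ≠ 0 := fun h => hs (eq_neg_of_add_eq_zero_left h)
  have hsin : Complex.sin (Real.pi * (s + m)) = (-1) ^ m * Complex.sin (Real.pi * s) := by
    rw [mul_add, mul_comm (Real.pi : ℂ) m, Complex.sin_antiperiodic.add_nat_mul_eq]
  have hone : ((-1 : ℂ) ^ m) * (-1) ^ m = 1 := by rw [← mul_pow]; simp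
  have hm0 : ((-1 : ℂ) ^ m) ≠ 0 := by simp
  rw [correctedSeries, balancedSeries, qSeries_eq_add_erase m hℓ s ht, one_sub_exp_mul, hsin]
  have e1 : ((-ℓ : ℝ) * ((s + m) * expSlope (ℓ * (s + m))))⁻¹ * (s + m) =
      (-(ℓ * expSlope (ℓ * (s + m))))⁻¹ := by
    push_cast
    rw [show -(ℓ : ℂ) * ((s + m) * expSlope (ℓ * (s + m))) =
      -(ℓ * expSlope (ℓ * (s + m))) * (s + m) by ring, mul_inv, mul_assoc, inv_mul_cancel₀ hs0,
      mul_one]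
  have e2 : (-1) ^ m * (Real.pi / ℓ) * ((s + m)⁻¹ * ((-1) ^ m * Complex.sin (Real.pi * s)))⁻¹ =
      (s + m) * (Real.pi / (ℓ * Complex.sin (Real.pi * s))) := by
    rw [mul_inv, mul_inv, inv_inv, ← div_div, div_eq_mul_inv (Real.pi / (ℓ : ℂ)) (Complex.sin _)]
    field_simp
  linear_combination -(Complex.exp (ℓ * s) * (1 - Complex.exp ℓ) ^ s) * risingCoeff s m *
    Complex.exp (ℓ * z) ^ m * e1 + (Complex.exp (ℓ * s) * (1 - Complex.exp ℓ) ^ s) *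
    Complex.exp (-(ℓ * s * z)) * e2

/-! ### Nonpositive integers and the classical limit -/

lemma mem_nonintegers_of_mem_closedBall {m : ℕ} {s : ℂ}
    (hs : s ∈ Metric.closedBall (-(m : ℂ)) (1 / 2)) (hne : s ≠ -m) : s ∈ nonintegers := by
  rintro n rfl
  rw [Metric.mem_closedBall, dist_eq_norm, sub_neg_eq_add] at hs
  have h1 : ‖((n + m : ℤ) : ℂ)‖ ≤ 1 / 2 := by push_cast; exact hs
  rw [Complex.norm_intCast] at h1
  have h2 : (n + m : ℤ) = 0 := by
    by_contra h
    have : (1 : ℝ) ≤ |((n + m : ℤ) : ℝ)| := by exact_mod_cast Int.one_le_abs h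
    linarith
  refine hne ?_
  have : ((n + m : ℤ) : ℂ) = 0 := by rw [h2]; simp
  push_cast at this
  linear_combination this

/-- Off the nonpositive integers, `1 - q ^ (s + r)` vanishes for no `r` near `s = -m`. -/
lemma eventually_exp_mul_add_ne_one {ℓ : ℝ} (hℓ : ℓ < 0) (m : ℕ) :
    ∀ᶠ s : ℂ in 𝓝[≠] (-(m : ℂ)), s ∈ nonintegers ∧ ∀ r : ℕ, Complex.exp (ℓ * (s + r)) ≠ 1 := by
  have h1 : ∀ᶠ s : ℂ in 𝓝[≠] (-(m : ℂ)), |ℓ * s.im| < 2 * Real.pi := by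
    refine Eventually.filter_mono nhdsWithin_le_nhds ?_
    refine (Continuous.tendsto (by fun_prop : Continuous fun s : ℂ => |ℓ * s.im|)
      (-(m : ℂ))).eventually_lt_const ?_
    simp [Real.pi_pos]
  filter_upwards [h1, self_mem_nhdsWithin, mem_nhdsWithin_of_mem_nhds
    (Metric.closedBall_mem_nhds (-(m : ℂ)) (by norm_num : (0 : ℝ) < 1 / 2))] with s hs hne hb
  have hn := mem_nonintegers_of_mem_closedBall hb hne
  exact ⟨hn, fun r => exp_mul_add_ne_one hℓ.ne (add_natCast_ne_zero hn r) hs⟩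

/-- The value at `s = -m` of the corrected zeta function for `q = exp ℓ`, with the singularity
removed. -/
noncomputable def removedValue (ℓ : ℝ) (z : ℂ) (m : ℕ) : ℂ :=
  limUnder (𝓝[≠] (-(m : ℂ))) fun s => Complex.exp (ℓ * s) * correctedSeries ℓ s z

lemma tendsto_removedValue {ℓ : ℝ} (hℓ : ℓ < 0) {z : ℂ} (hz : 0 < z.re) (m : ℕ) :
    Tendsto (fun s : ℂ => Complex.exp (ℓ * s) * correctedSeries ℓ s z) (𝓝[≠] (-(m : ℂ)))
      (𝓝 (removedValue ℓ z m)) := by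
  refine Complex.tendsto_limUnder_of_differentiable_on_punctured_nhds_of_isLittleO ?_ ?_
  · filter_upwards [eventually_exp_mul_add_ne_one hℓ m] with s hs
    exact (analyticAt_correctedSeries hℓ hz hs.1 hs.2).differentiableAt
  · refine (Asymptotics.isLittleO_iff_tendsto' ?_).2 ?_
    · filter_upwards [self_mem_nhdsWithin] with s hs h
      exact absurd (inv_eq_zero.1 h) (sub_ne_zero.2 hs)
    · have h0 : Tendsto (fun s : ℂ => s + m) (𝓝[≠] (-(m : ℂ))) (𝓝 0) :=
        Tendsto.mono_left (Continuous.tendsto' (by fun_prop) _ _ (by simp)) nhdsWithin_le_nhds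
      have h := (tendsto_mul_correctedSeries hℓ hz m).sub (h0.mul_const
        (Complex.exp (ℓ * -(m : ℂ)) * correctedSeries ℓ (-m) z))
      rw [zero_mul, sub_zero] at h
      refine h.congr fun s => ?_
      rw [sub_neg_eq_add, div_inv_eq_mul]
      ring

/-- Cauchy's formula on a circle around `-m` expresses the removed value through values at
nonintegers. -/
lemma circleIntegral_correctedSeries {ℓ : ℝ} (hℓ : ℓ < 0) (hℓ1 : -1 < ℓ) {z : ℂ} (hz : 0 < z.re)
    (m : ℕ) :
    (∮ s in C(-(m : ℂ), 1 / 2), (s - -m)⁻¹ • (Complex.exp (ℓ * s) * correctedSeries ℓ s z)) =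
      (2 * Real.pi * Complex.I : ℂ) • removedValue ℓ z m := by
  classical
  set f : ℂ → ℂ := fun s => Complex.exp (ℓ * s) * correctedSeries ℓ s z with hf
  set g := Function.update f (-(m : ℂ)) (removedValue ℓ z m) with hg
  have han : ∀ s ∈ Metric.closedBall (-(m : ℂ)) (1 / 2), s ≠ -m → AnalyticAt ℂ f s := by
    intro s hs hne
    have hn := mem_nonintegers_of_mem_closedBall hs hne
    refine analyticAt_correctedSeries hℓ hz hn fun r =>
      exp_mul_add_ne_one hℓ.ne (add_natCast_ne_zero hn r) ?_
    have h1 : |s.im| ≤ 1 / 2 := by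
      have h2 := Complex.abs_im_le_norm (s - -m)
      rw [Metric.mem_closedBall, dist_eq_norm] at hs
      simp at h2 hs
      linarith
    rw [abs_mul, abs_of_neg hℓ]
    have := Real.pi_gt_three
    nlinarith [abs_nonneg s.im]
  have hgf : ∀ s, s ≠ -(m : ℂ) → g =ᶠ[𝓝 s] f := fun s hne => by
    filter_upwards [isOpen_ne.mem_nhds hne] with w hw using Function.update_of_ne hw _ _
  have hgan : ∀ s ∈ Metric.closedBall (-(m : ℂ)) (1 / 2), s ≠ -m → AnalyticAt ℂ g s :=
    fun s hs hne => (han s hs hne).congr (hgf s hne).symm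
  have hcont : ContinuousOn g (Metric.closedBall (-(m : ℂ)) (1 / 2)) := by
    intro s hs
    by_cases hne : s = -m
    · rw [hne]
      exact (continuousAt_update_same.2 (tendsto_removedValue hℓ hz m)).continuousWithinAt
    · exact (hgan s hs hne).continuousAt.continuousWithinAt
  have h := Complex.circleIntegral_sub_inv_smul_of_differentiable_on_off_countable
    (Set.countable_singleton (-(m : ℂ))) (Metric.mem_ball_self (by norm_num)) hcont
    fun s hs => (hgan s (Metric.ball_subset_closedBall hs.1) hs.2).differentiableAt
  rw [show g (-m) = removedValue ℓ z m from Function.update_self _ _ _] at h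
  rw [← h]
  refine circleIntegral.integral_congr (by norm_num) fun s hs => ?_
  have hne : s ≠ -m := by
    rintro rfl
    simp at hs
  simp only [hg, Function.update_of_ne hne, hf]

/-- The limit `q → 1` at nonintegers, jointly in `s`. -/
lemma tendsto_exp_mul_correctedSeries {s₀ z : ℂ} (hs : s₀ ∈ nonintegers) (hz : 0 < z.re) :
    Tendsto (fun p : ℝ × ℂ => Complex.exp (p.1 * p.2) * correctedSeries p.1 p.2 z)
      (𝓝[<] 0 ×ˢ 𝓝 s₀) (𝓝 (hurwitzEntire s₀ z / (s₀ - 1))) := by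
  have hn : 1 - ((⌈1 - s₀.re⌉₊ + 1 : ℕ) : ℝ) < s₀.re := by
    have := Nat.le_ceil (1 - s₀.re)
    push_cast
    linarith
  have m : Tendsto (fun p : ℝ × ℂ => ((p.1, p.2, z) : ℝ × ℂ × ℂ)) (𝓝[<] 0 ×ˢ 𝓝 s₀)
      (𝓝[<] 0 ×ˢ 𝓝 (s₀, z)) :=
    tendsto_fst.prodMk (tendsto_snd.prodMk_nhds tendsto_const_nhds)
  have h1 := (tendsto_correctedSeries _ hs hn hz).comp m
  have h2 : Tendsto (fun p : ℝ × ℂ => Complex.exp (p.1 * p.2)) (𝓝[<] 0 ×ˢ 𝓝 s₀) (𝓝 1) := by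
    simpa using ((tendsto_ell (s₀ := s₀) (z₀ := z)).comp m |>.mul
      (tendsto_snd : Tendsto Prod.snd (𝓝[<] (0 : ℝ) ×ˢ 𝓝 s₀) (𝓝 s₀))).cexp
  simpa [hurwitzEntire] using h2.mul h1

/-- The removed values converge: the convergence on the circle is transferred to its center. -/
lemma tendsto_removedValue_of_ell {z : ℂ} (hz : 0 < z.re) (m : ℕ) :
    Tendsto (fun ℓ : ℝ => removedValue ℓ z m) (𝓝[<] 0)
      (𝓝 (hurwitzEntire (-m) z / (-m - 1))) := by
  have hcirc : ∀ θ : ℝ, circleMap (-(m : ℂ)) (1 / 2) θ ∈ Metric.closedBall (-(m : ℂ)) (1 / 2) ∧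
      circleMap (-(m : ℂ)) (1 / 2) θ ≠ -m := fun θ =>
    ⟨circleMap_mem_closedBall _ (by norm_num) θ, circleMap_ne_center (by norm_num)⟩
  have hnon : ∀ θ : ℝ, circleMap (-(m : ℂ)) (1 / 2) θ ∈ nonintegers := fun θ =>
    mem_nonintegers_of_mem_closedBall (hcirc θ).1 (hcirc θ).2
  have hlim : Tendsto (fun ℓ : ℝ => ∮ s in C(-(m : ℂ), 1 / 2),
      (s - -m)⁻¹ • (Complex.exp (ℓ * s) * correctedSeries ℓ s z)) (𝓝[<] 0)
      (𝓝 (∮ s in C(-(m : ℂ), 1 / 2), (s - -m)⁻¹ • (hurwitzEntire s z / (s - 1)))) := by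
    unfold circleIntegral
    have hker : Continuous fun θ : ℝ => deriv (circleMap (-(m : ℂ)) (1 / 2)) θ := by
      simp only [deriv_circleMap]
      fun_prop
    have hinv : Continuous fun θ : ℝ => (circleMap (-(m : ℂ)) (1 / 2) θ - -m)⁻¹ :=
      Continuous.inv₀ (by fun_prop) fun θ => sub_ne_zero.2 (hcirc θ).2
    refine tendsto_intervalIntegral_of_tendsto_prod (by positivity) (fun θ _ => ?_) ?_
    · have h1 : Tendsto (fun p : ℝ × ℝ => ((p.1, circleMap (-(m : ℂ)) (1 / 2) p.2) : ℝ × ℂ))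
          (𝓝[<] 0 ×ˢ 𝓝[Set.Icc 0 (2 * Real.pi)] θ)
          (𝓝[<] 0 ×ˢ 𝓝 (circleMap (-(m : ℂ)) (1 / 2) θ)) :=
        tendsto_fst.prodMk (((continuous_circleMap _ _).tendsto θ).comp
          (tendsto_snd.mono_right nhdsWithin_le_nhds))
      have h2 := (tendsto_exp_mul_correctedSeries (hnon θ) hz).comp h1
      have h3 : Tendsto (fun p : ℝ × ℝ => p.2) (𝓝[<] 0 ×ˢ 𝓝[Set.Icc 0 (2 * Real.pi)] θ) (𝓝 θ) :=
        tendsto_snd.mono_right nhdsWithin_le_nhds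
      exact ((hker.tendsto θ).comp h3).smul (((hinv.tendsto θ).comp h3).smul h2)
    · filter_upwards [Ioo_mem_nhdsLT (show (-1 : ℝ) < 0 by norm_num)] with ℓ hℓ
      refine Continuous.continuousOn (hker.smul (hinv.smul ?_))
      refine continuous_iff_continuousAt.2 fun θ => ?_
      have h1 := (analyticAt_correctedSeries hℓ.2 hz (hnon θ) fun r =>
        exp_mul_add_ne_one hℓ.2.ne (add_natCast_ne_zero (hnon θ) r) ?_).continuousAt
      · exact ContinuousAt.comp (f := circleMap (-(m : ℂ)) (1 / 2)) h1
          (continuous_circleMap _ _).continuousAt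
      · have h2 : |(circleMap (-(m : ℂ)) (1 / 2) θ).im| ≤ 1 / 2 := by
          have h3 := Complex.abs_im_le_norm (circleMap (-(m : ℂ)) (1 / 2) θ - -m)
          have h4 := (hcirc θ).1
          rw [Metric.mem_closedBall, dist_eq_norm] at h4
          have h5 := h3.trans h4
          simpa using h5
        rw [abs_mul, abs_of_neg hℓ.2]
        have := Real.pi_gt_three
        have := hℓ.1
        nlinarith [abs_nonneg (circleMap (-(m : ℂ)) (1 / 2) θ).im]
  have hcauchy : (∮ s in C(-(m : ℂ), 1 / 2), (s - -m)⁻¹ • (hurwitzEntire s z / (s - 1))) =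
      (2 * Real.pi * Complex.I : ℂ) • (hurwitzEntire (-m) z / (-m - 1)) := by
    refine DifferentiableOn.circleIntegral_sub_inv_smul
      (f := fun s => hurwitzEntire s z / (s - 1)) (fun s hs => ?_)
      (Metric.mem_ball_self (by norm_num))
    have hs1 : s - 1 ≠ 0 := by
      rw [sub_ne_zero]
      rintro rfl
      rw [Metric.mem_closedBall, dist_eq_norm, sub_neg_eq_add] at hs
      have h1 : (1 : ℝ) + m ≤ ‖(1 : ℂ) + m‖ := by
        simpa using Complex.re_le_norm ((1 : ℂ) + m)
      have : (0 : ℝ) ≤ m := m.cast_nonneg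
      linarith
    exact ((differentiable_hurwitzEntire hz s).div (by fun_prop) hs1).differentiableWithinAt
  have hpi : (2 * Real.pi * Complex.I : ℂ) ≠ 0 := Complex.two_pi_I_ne_zero
  rw [hcauchy] at hlim
  have h := hlim.const_smul (2 * Real.pi * Complex.I : ℂ)⁻¹
  rw [inv_smul_smul₀ hpi] at h
  refine h.congr' ?_
  filter_upwards [Ioo_mem_nhdsLT (show (-1 : ℝ) < 0 by norm_num)] with ℓ hℓ
  rw [circleIntegral_correctedSeries hℓ.2 hℓ.1 hz m, inv_smul_smul₀ hpi]

lemma tendsto_log_nhdsLT_one : Tendsto Real.log (𝓝[<] 1) (𝓝[<] 0) := by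
  refine tendsto_nhdsWithin_iff.2 ⟨?_, ?_⟩
  · have h := (Real.continuousAt_log one_ne_zero).tendsto
    rw [Real.log_one] at h
    exact h.mono_left nhdsWithin_le_nhds
  · filter_upwards [Ioo_mem_nhdsLT (show (0 : ℝ) < 1 by norm_num)] with q hq
    exact Real.log_neg hq.1 hq.2

theorem mainTheorem3 (z : ℂ) (hz : 0 < z.re) :
    -- the Hurwitz zeta function is the continuation of its series, holomorphic off `s = 1`
    (IsSeriesContinuation (hurwitzTerm z) 1 (complexHurwitzZeta z) ∧
      DifferentiableOn ℂ (complexHurwitzZeta z) {1}ᶜ) ∧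
    -- the `q`-Hurwitz zeta function is the continuation of its series, and its poles are among
    -- the points `-r + 2πi l / log q`
    (∀ q : ℝ, 0 < q → q < 1 →
      IsSeriesContinuation (qHurwitzTerm q z) 0 (qHurwitzZeta q z) ∧
      DifferentiableOn ℂ (qHurwitzZeta q z)
        {s : ℂ | ∀ (r : ℕ) (l : ℤ),
          s ≠ -(r : ℂ) + 2 * (Real.pi : ℂ) * Complex.I / ((Real.log q : ℝ) : ℂ) * (l : ℂ)}) ∧
    -- the classical limit at the points `s` that are not integers
    (∀ s : ℂ, (∀ n : ℤ, s ≠ (n : ℂ)) →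
      Tendsto (fun q : ℝ => correctedQHurwitzZeta q z s) (𝓝[<] (1 : ℝ))
        (𝓝 (complexHurwitzZeta z s))) ∧
    -- the classical limit at `s = -m`, where the singularity in `s` of the corrected function
    -- is removable and `L q` is the value that removes it
    (∀ m : ℕ, ∃ L : ℝ → ℂ,
      (∀ q : ℝ, 0 < q → q < 1 →
        Tendsto (fun s : ℂ => correctedQHurwitzZeta q z s) (𝓝[≠] (-(m : ℂ))) (𝓝 (L q))) ∧
      Tendsto L (𝓝[<] (1 : ℝ)) (𝓝 (complexHurwitzZeta z (-(m : ℂ))))) := by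
  have hH := isSeriesContinuation_hurwitz hz
  have hHeq : complexHurwitzZeta z = fun s => hurwitzEntire s z / (s - 1) :=
    hH.eq_seriesContinuation
  refine ⟨⟨by rwa [hHeq], ?_⟩, fun q h0 h1 => ⟨?_, ?_⟩, fun s hs => ?_, fun m => ?_⟩
  · rw [hHeq]
    intro s hs
    have hne : s ≠ 1 := hs
    have hs1 : s - 1 ≠ 0 := sub_ne_zero.2 hne
    have h2 : DifferentiableAt ℂ (fun s : ℂ => s - 1) s := by fun_prop
    have h := (differentiable_hurwitzEntire hz s).div h2 hs1
    exact h.differentiableWithinAt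
  · have hq := isSeriesContinuation_qHurwitz h0 h1 hz
    rw [qHurwitzZeta, hq.eq_seriesContinuation]
    exact hq
  · intro s hs
    refine (analyticAt_qHurwitzZeta h0 h1 hz fun r hr => ?_).differentiableAt.differentiableWithinAt
    obtain ⟨l, hl⟩ := Complex.exp_eq_one_iff.1 hr
    have hℓ0 : ((Real.log q : ℝ) : ℂ) ≠ 0 := by exact_mod_cast (Real.log_neg h0 h1).ne
    refine hs r l ?_
    field_simp
    linear_combination hl
  · rw [hHeq]
    have h1 : Tendsto (fun q : ℝ => (Real.log q, s)) (𝓝[<] 1) (𝓝[<] 0 ×ˢ 𝓝 s) :=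
      tendsto_log_nhdsLT_one.prodMk tendsto_const_nhds
    refine ((tendsto_exp_mul_correctedSeries hs hz).comp h1).congr' ?_
    have h2 : Tendsto (fun q : ℝ => |Real.log q * s.im|) (𝓝[<] 1) (𝓝 0) := by
      simpa using ((tendsto_log_nhdsLT_one.mono_right nhdsWithin_le_nhds).mul_const s.im).abs
    filter_upwards [Ioo_mem_nhdsLT (show (0 : ℝ) < 1 by norm_num),
      h2.eventually_lt_const Real.two_pi_pos] with q hq hq2
    exact (correctedQHurwitzZeta_eq hq.1 hq.2 hz fun r => exp_mul_add_ne_one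
      (Real.log_neg hq.1 hq.2).ne (add_natCast_ne_zero hs r) hq2).symm
  · refine ⟨fun q => removedValue (Real.log q) z m, fun q h0 h1 => ?_, ?_⟩
    · have hℓ := Real.log_neg h0 h1
      refine (tendsto_removedValue hℓ hz m).congr' ?_
      filter_upwards [eventually_exp_mul_add_ne_one hℓ m] with s hs
      exact (correctedQHurwitzZeta_eq h0 h1 hz hs.2).symm
    · rw [hHeq]
      exact (tendsto_removedValue_of_ell hz m).comp tendsto_log_nhdsLT_one
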